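/- Let $\mathbb{K}\subseteq\mathbb{C}$ be a unital subring and let $R$ be a $\mathbb{K}$-algebra with a finite $\mathbb{K}$-basis $C=\{1=c_0,\dots,c_{r-1}\}$ such that $c_ic_j=\sum_k m_{i,j}^k c_k$ with all $m_{i,j}^k\in\mathbb{R}_{\ge 0}$ (a finite based $\mathbb{R}_{\ge0}$-algebra). Let $c=\sum_i a_ic_i$ with arbitrary $a_i\in\mathbb{R}_{\ge 0}$ and let $b_n$ be the sum of the coefficients of $c^n$ with respect to $C$ (computed in $\mathbb{C}\otimes_{\mathbb{K}}R$). Let $M=M(c)$ be the action matrix: the submatrix of $\big(\sum_i a_im_{i,j}^k\big)_{k,j}$ on the connected component (ignoring orientation) of $1\in C$ in the graph of that matrix. Then $M$ has a Perron–Frobenius eigenvalue $\lambda=\mathrm{PFdim}\,c\in\mathbb{R}_{\ge0}$, i.e. an eigenvalue with $\lambda\ge|\mu|$ for all eigenvalues $\mu$ of $M$. If $s$ is its algebraic multiplicity, there are periods $h_1,\dots,h_s\in\mathbb{Z}_{\ge1}$ such that the eigenvalues of $M$ of modulus $\lambda$, counted with multiplicity, are the numbers $\exp(2\pi i k/h_\ell)\lambda$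 with $1\le\ell\le s$, $0\le k<h_\ell$. Moreover $$\lim_{n\to\infty}\sqrt[n]{b_n}=\lambda .$$ If $\lambda=0$, then $b_n=0$ for all large $n$. Suppose $\lambda>0$ and put $h=\mathrm{lcm}(h_1,\dots,h_s)$, $\zeta=\exp(2\pi i/h)$; let $\nu$ be the maximal size of a Jordan block of $M$ with eigenvalue $\lambda$, and let $|\lambda^{sec}|$ be the largest modulus of an eigenvalue of $M$ of modulus $<\lambda$ ($0$ if there is none). Say that $f(n)\to l$ geometrically with ratio $\beta\in[0,1)$ if $(f(n)-l)/\gamma^n$ is bounded for every $\gamma\in(\beta,1)$. Then there are unique real matrices $S^0(n),\dots,S^{h-1}(n)$ whose entries are polynomials in $n$ of degree at most $\nu-1$, such that for each $i\in\{0,\dots,h-1\}$ the matrices $(M/\lambda)^{hn+i}-S^i(n)$ tend to $0$ entrywise, geometrically with ratio $|\lambda^{sec}/\lambda|^h$ (Rothblum's expansion). Writing $S^j(x)[1]$ for the sum of the entries of the column of $S^j(x)$ indexed by $1\in C$, and $$a(n)=\Big(\frac1h\sum_{i=0}^{h-1}\sum_{j=0}^{h-1}S^j\big(\lfloor n/h\rfloor\big)[1]\cdot\zeta^{i(n-j)}\Big)\cdot\lambda^n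 ,$$ we have $b_n\sim a(n)$, and $b_n/a(n)\to1$ geometrically with ratio $|\lambda^{sec}/\lambda|$. -/

import Mathlib

open scoped TensorProduct Polynomial NNReal

noncomputable section

/-- A finite based `ℝ≥0`-algebra over a unital subring `K ⊆ ℂ`: a `K`-algebra `R` with a finite
`K`-basis `C = (c_i)` containing the unit, all of whose structure constants are nonnegative reals. -/
structure FiniteBasedAlgebra (K : Subring ℂ) (R ι : Type*) [Ring R] [Algebra K R] where
  basis : Module.Basis ι K R
  /-- the index of the unit in the basis -/
  e : ι
  basis_e : basis e = 1
  nonneg : ∀ i j k, ∃ x : ℝ, 0 ≤ x ∧ ((basis.repr (basis i * basis j) k : K) : ℂ) = (x : ℂ)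

namespace FiniteBasedAlgebra

variable {K : Subring ℂ} {R ι : Type*} [Ring R] [Algebra K R] [Fintype ι]

/-- The structure constants: `c_i c_j = ∑ k, m_{i,j}^k c_k`. -/
def structConst (A : FiniteBasedAlgebra K R ι) (i j k : ι) : ℝ :=
  ((A.basis.repr (A.basis i * A.basis j) k : K) : ℂ).re

/-- The element `c = ∑ i, a_i c_i` with coefficients `a_i ∈ ℝ≥0`. The `a_i` need not lie in `K`,
so `c` lives in the scalar extension of `R` to `ℂ`, which has the same structure constants. -/
def elem (A : FiniteBasedAlgebra K R ι) (a : ι → ℝ≥0) : ℂ ⊗[K] R :=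
  ∑ i, (((a i : ℝ) : ℂ) ⊗ₜ[K] A.basis i)

/-- The coefficient of `c_k` in `c ^ n` (a nonnegative real number). -/
def powCoeff (A : FiniteBasedAlgebra K R ι) (a : ι → ℝ≥0) (n : ℕ) (k : ι) : ℝ :=
  ((Algebra.TensorProduct.basis ℂ A.basis).repr (A.elem a ^ n) k).re

/-- `b_n`: the total sum of the coefficients of `c ^ n`. -/
def b (A : FiniteBasedAlgebra K R ι) (a : ι → ℝ≥0) (n : ℕ) : ℝ :=
  ∑ k, A.powCoeff a n k

/-- The pre-action matrix `M'(c)_{k,j} = ∑ i, a_i m_{i,j}^k`. -/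
def preActionMatrix (A : FiniteBasedAlgebra K R ι) (a : ι → ℝ≥0) : Matrix ι ι ℝ :=
  Matrix.of fun k j => ∑ i, (a i : ℝ) * A.structConst i j k

/-- The connected component (ignoring orientations) of the unit in the graph of `M'(c)`. -/
def component (A : FiniteBasedAlgebra K R ι) (a : ι → ℝ≥0) : Set ι :=
  {j | Relation.EqvGen (fun x y => A.preActionMatrix a x y ≠ 0) A.e j}

instance (A : FiniteBasedAlgebra K R ι) (a : ι → ℝ≥0) : Fintype (A.component a) :=
  Fintype.ofFinite _

/-- The unit, as a vertex of its component. -/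
def unitVertex (A : FiniteBasedAlgebra K R ι) (a : ι → ℝ≥0) : A.component a :=
  ⟨A.e, Relation.EqvGen.refl _⟩

/-- The action matrix `M(c)`. -/
def actionMatrix (A : FiniteBasedAlgebra K R ι) (a : ι → ℝ≥0) :
    Matrix (A.component a) (A.component a) ℝ :=
  (A.preActionMatrix a).submatrix Subtype.val Subtype.val

end FiniteBasedAlgebra

section Matrices

variable {m : Type*} [Fintype m] [DecidableEq m]

/-- The complex eigenvalues of a real matrix, with algebraic multiplicity. -/
def eigs (M : Matrix m m ℝ) : Multiset ℂ :=
  (M.map Complex.ofReal).charpoly.roots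

/-- `lam` is the Perron--Frobenius eigenvalue: a nonnegative real eigenvalue that is at least the
modulus of every eigenvalue. -/
def IsPFEigenvalue (M : Matrix m m ℝ) (lam : ℝ) : Prop :=
  0 ≤ lam ∧ (lam : ℂ) ∈ eigs M ∧ ∀ μ ∈ eigs M, ‖μ‖ ≤ lam

open Classical in
/-- `hs = {h_1, …, h_s}` is the multiset of periods of `M`, where `s` is the multiplicity of the
Perron--Frobenius eigenvalue `lam`: the eigenvalues of modulus `lam`, with multiplicity, are the
numbers `exp (k 2πi / h_l) * lam` for `1 ≤ l ≤ s` and `0 ≤ k < h_l`. -/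
def IsPeriods (M : Matrix m m ℝ) (lam : ℝ) (hs : Multiset ℕ) : Prop :=
  Multiset.card hs = (eigs M).count (lam : ℂ) ∧
  (∀ h ∈ hs, 1 ≤ h) ∧
  (eigs M).filter (fun μ => ‖μ‖ = lam) =
    hs.bind fun h => (Multiset.range h).map fun k =>
      Complex.exp (k * (2 * Real.pi * Complex.I / h)) * (lam : ℂ)

/-- The modulus of a second largest eigenvalue: the largest modulus of an eigenvalue of modulus
`< lam`, and `0` if there is no such eigenvalue. -/
def secModulus (M : Matrix m m ℝ) (lam : ℝ) : ℝ :=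
  sSup {x : ℝ | ∃ μ ∈ eigs M, ‖μ‖ < lam ∧ x = ‖μ‖}

/-- The maximal size of a Jordan block of `M` with eigenvalue `lam`, i.e. the least `k` such that
`ker (M - lam) ^ k` is the whole generalized eigenspace. -/
def jordanIndex (M : Matrix m m ℝ) (lam : ℝ) : ℕ :=
  Module.End.maxGenEigenspaceIndex (Matrix.toLin' M) lam

/-- `f n → l` geometrically with ratio `β ∈ [0,1)`: for each `γ ∈ (β,1)` the sequence
`(f n - l) / γ ^ n` is bounded. -/
def ConvergesGeometrically {E : Type*} [NormedAddCommGroup E] (f : ℕ → E) (l : E) (β : ℝ) : Prop :=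
  0 ≤ β ∧ β < 1 ∧ ∀ γ : ℝ, β < γ → γ < 1 → ∃ B : ℝ, ∀ n, ‖f n - l‖ / γ ^ n ≤ B

/-- The polynomial matrices `S^0(n), …, S^{h-1}(n)` of Rothblum's expansion of the powers of
`M / lam`: the entries have degree at most `ν - 1`, and `(M / lam) ^ (h n + i) - S^i(n)` tends to
`0` entrywise, geometrically with ratio `|lam_sec / lam| ^ h`. -/
def IsRothblumExpansion (M : Matrix m m ℝ) (lam : ℝ) (h : ℕ)
    (S : Fin h → Matrix m m ℝ[X]) : Prop :=
  ∀ (i : Fin h) (k l : m),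
    (S i k l).natDegree ≤ jordanIndex M lam - 1 ∧
    Filter.Tendsto (fun n : ℕ => ((lam⁻¹ • M) ^ (h * n + (i : ℕ))) k l - (S i k l).eval (n : ℝ))
      Filter.atTop (nhds 0) ∧
    ConvergesGeometrically
      (fun n : ℕ => ((lam⁻¹ • M) ^ (h * n + (i : ℕ))) k l - (S i k l).eval (n : ℝ))
      0 ((secModulus M lam / lam) ^ h)

/-- `S[1]`: the sum of the entries in column `u` of the polynomial matrix `S`, evaluated at `x`. -/
def columnSum (S : Matrix m m ℝ[X]) (u : m) (x : ℝ) : ℝ :=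
  ∑ k, (S k u).eval x

/-- `a(n) = (1/h ∑_{i<h} ∑_{j<h} S^j(⌊n/h⌋)[1] ζ^{i(n-j)}) lam^n` with `ζ = exp (2πi/h)`. -/
def asymptoticFormula (lam : ℝ) (h : ℕ) (S : Fin h → Matrix m m ℝ[X]) (u : m) (n : ℕ) : ℂ :=
  (1 / (h : ℂ) * ∑ i : Fin h, ∑ j : Fin h,
    (columnSum (S j) u ((n / h : ℕ) : ℝ) : ℂ) *
      Complex.exp (2 * Real.pi * Complex.I / h) ^ (((i : ℕ) : ℤ) * ((n : ℤ) - ((j : ℕ) : ℤ)))) *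
    (lam : ℂ) ^ n

end Matrices

end

/-! Left multiplication by `c` identifies `b_n` with the sum of the unit column of `M ^ n`, so the
theorem is about powers of a nonnegative matrix, plus one feature of the algebra: `c ^ n * c_j` is
determined by `c ^ n`, hence the unit column controls all entries of `M ^ n` up to a constant
(`exists_sum_actionMatrix_pow_le`). The entries of `M ^ n` sum to at least `λ ^ n`, so `b_n ≥ C⁻¹ λ
^ n`. With Gelfand's upper bound this gives the root limit; it also keeps the polynomial factor of
`a(n)` away from `0`, so an additive error becomes a relative one.

For irreducible `M`, Wielandt's equality case of the triangle inequality shows that a peripheral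
eigenvalue `zλ` makes `M` similar to `zM`. The peripheral phases therefore form a finite group of
roots of unity, all with the same multiplicity. A reducible matrix is block triangular, and its
blocks contribute the union of their families.

With `T = M/λ` and `h` the lcm of the periods, every peripheral eigenvalue of `T` is an `h`-th root
of unity. On one Fitting summand `T ^ h - 1` is nilpotent, and the binomial theorem yields the
polynomials `S^i`; on the other, `T` decays at the rate of the secondary eigenvalue. The degree
bound needs positivity: leading coefficients of different residue classes are nonnegative and cannot
cancel, so no peripheral Jordan block beats those at `λ` (`exists_sub_one_pow_mul_ne_zero`). The
Fourier sum in `a(n)` merely selects `S^{n mod h}`. -/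

open Matrix Filter

/-! ### Eigenvalues, growth of powers, finite groups of complex numbers -/

section Spectrum

variable {m : Type*} [Fintype m] [DecidableEq m]

theorem mem_eigs_iff_mem_spectrum (M : Matrix m m ℝ) (μ : ℂ) :
    μ ∈ eigs M ↔ μ ∈ spectrum ℂ (M.map Complex.ofReal) := by
  rw [eigs, Polynomial.mem_roots (Matrix.charpoly_monic _).ne_zero,
    Matrix.mem_spectrum_iff_isRoot_charpoly]

theorem mem_eigs_iff (M : Matrix m m ℝ) (μ : ℂ) :
    μ ∈ eigs M ↔ ∃ v : m → ℂ, v ≠ 0 ∧ (M.map Complex.ofReal) *ᵥ v = μ • v := by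
  rw [mem_eigs_iff_mem_spectrum, ← Matrix.spectrum_toLin',
    ← Module.End.hasEigenvalue_iff_mem_spectrum]
  constructor
  · intro h
    obtain ⟨v, hv⟩ := h.exists_hasEigenvector
    exact ⟨v, hv.2, by simpa using hv.apply_eq_smul⟩
  · rintro ⟨v, hv, h⟩
    exact Module.End.hasEigenvalue_of_hasEigenvector
      ⟨Module.End.mem_eigenspace_iff.2 (by simpa using h), hv⟩

theorem map_ofReal_pow (M : Matrix m m ℝ) (n : ℕ) :
    (M ^ n).map Complex.ofReal = (M.map Complex.ofReal) ^ n :=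
  map_pow (Complex.ofRealHom.mapMatrix (m := m)) M n

attribute [local instance] Matrix.linftyOpNormedRing Matrix.linftyOpNormedAlgebra in
/-- The entries of the powers of a matrix grow no faster than its spectral radius allows. -/
theorem exists_abs_pow_apply_le (M : Matrix m m ℝ) {β γ : ℝ} (hβ : 0 ≤ β)
    (h : ∀ μ ∈ eigs M, ‖μ‖ ≤ β) (hγ : β < γ) :
    ∃ B : ℝ, 0 < B ∧ ∀ n i j, |(M ^ n) i j| ≤ B * γ ^ n := by
  set A := M.map Complex.ofReal with hA
  have hγ0 : 0 < γ := hβ.trans_lt hγ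
  have hrad : spectralRadius ℂ A < ENNReal.ofReal γ := by
    refine lt_of_le_of_lt (b := ENNReal.ofReal β) (iSup₂_le fun μ hμ => ?_)
      ((ENNReal.ofReal_lt_ofReal_iff hγ0).2 hγ)
    rw [← enorm_eq_nnnorm, ← ofReal_norm]
    exact ENNReal.ofReal_le_ofReal (h μ ((mem_eigs_iff_mem_spectrum M μ).2 hμ))
  -- Gelfand's formula bounds `‖A ^ n‖` by `γ ^ n` only for large `n`; the finite sum in the
  -- constant below absorbs the remaining exponents.
  have hlim := spectrum.pow_nnnorm_pow_one_div_tendsto_nhds_spectralRadius A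
  have hev : ∀ᶠ n : ℕ in atTop, ‖A ^ n‖ ≤ γ ^ n := by
    filter_upwards [hlim.eventually_lt_const hrad, eventually_gt_atTop 0] with n hn hn0
    have hn1 : (n : ℝ) ≠ 0 := by positivity
    have h2 := ENNReal.rpow_le_rpow hn.le (Nat.cast_nonneg (α := ℝ) n)
    rw [← ENNReal.rpow_mul, one_div_mul_cancel hn1, ENNReal.rpow_one, ENNReal.rpow_natCast,
      ← ENNReal.ofReal_pow hγ0.le, ← enorm_eq_nnnorm, ← ofReal_norm] at h2
    exact (ENNReal.ofReal_le_ofReal_iff (by positivity)).1 h2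
  obtain ⟨N, hN⟩ := eventually_atTop.1 hev
  refine ⟨1 + ∑ n ∈ Finset.range N, ‖A ^ n‖ / γ ^ n, ?_, fun n i j => ?_⟩
  · have : 0 ≤ ∑ n ∈ Finset.range N, ‖A ^ n‖ / γ ^ n := Finset.sum_nonneg fun _ _ => by positivity
    linarith
  have hent : |(M ^ n) i j| ≤ ‖A ^ n‖ := by
    have h1 : |(M ^ n) i j| = ‖(A ^ n) i j‖ := by
      rw [hA, ← map_ofReal_pow]; simp
    rw [h1, Matrix.linfty_opNorm_def]
    have h2 : ‖(A ^ n) i j‖₊ ≤ ∑ j, ‖(A ^ n) i j‖₊ :=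
      Finset.single_le_sum (f := fun j => ‖(A ^ n) i j‖₊) (fun _ _ => zero_le) (Finset.mem_univ j)
    have h3 : ∑ j, ‖(A ^ n) i j‖₊ ≤ Finset.univ.sup fun i => ∑ j, ‖(A ^ n) i j‖₊ :=
      Finset.le_sup (f := fun i => ∑ j, ‖(A ^ n) i j‖₊) (Finset.mem_univ i)
    exact_mod_cast h2.trans h3
  refine hent.trans ?_
  have hpos : 0 < γ ^ n := by positivity
  rw [← div_le_iff₀ hpos]
  have hsum : 0 ≤ ∑ n ∈ Finset.range N, ‖A ^ n‖ / γ ^ n :=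
    Finset.sum_nonneg fun _ _ => by positivity
  rcases lt_or_ge n N with hn | hn
  · have := Finset.single_le_sum (f := fun n => ‖A ^ n‖ / γ ^ n)
      (fun _ _ => by positivity) (Finset.mem_range.2 hn)
    linarith
  · have : ‖A ^ n‖ / γ ^ n ≤ 1 := (div_le_one hpos).2 (hN n hn)
    linarith

/-- A finite set of nonzero complex numbers closed under multiplication consists of all roots of
unity of some order. -/
theorem Finset.eq_image_exp_of_mul_mem (G : Finset ℂ) (hne : G.Nonempty) (h0 : (0 : ℂ) ∉ G)
    (hmul : ∀ x ∈ G, ∀ y ∈ G, x * y ∈ G) :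
    G = (Finset.range G.card).image fun k : ℕ =>
      Complex.exp (k * (2 * Real.pi * Complex.I / G.card)) := by
  have hcard : 0 < G.card := hne.card_pos
  have hpow : ∀ g ∈ G, g ^ G.card = 1 := by
    intro g hg
    have hg0 : g ≠ 0 := fun h => h0 (h ▸ hg)
    -- Multiplication by `g` permutes `G`, so comparing the product of all elements before and after
    -- gives `g ^ |G| = 1`.
    have himg : G.image (g * ·) = G := by
      refine Finset.eq_of_subset_of_card_le ?_ ?_
      · intro x hx
        obtain ⟨y, hy, rfl⟩ := Finset.mem_image.1 hx
        exact hmul g hg y hy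
      · rw [Finset.card_image_of_injective _ (mul_right_injective₀ hg0)]
    have hprod : ∏ x ∈ G, x = g ^ G.card * ∏ x ∈ G, x := by
      conv_lhs => rw [← himg]
      rw [Finset.prod_image fun x _ y _ h => mul_right_injective₀ hg0 h,
        Finset.prod_mul_distrib, Finset.prod_const]
    have hP : ∏ x ∈ G, x ≠ 0 := Finset.prod_ne_zero_iff.2 fun x hx h => h0 (h ▸ hx)
    exact (mul_eq_right₀ hP).1 hprod.symm
  have hprim := Complex.isPrimitiveRoot_exp G.card hcard.ne'
  have hexp : ∀ k : ℕ, Complex.exp (k * (2 * Real.pi * Complex.I / G.card)) =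
      Complex.exp (2 * Real.pi * Complex.I / G.card) ^ k := fun k => by rw [Complex.exp_nat_mul]
  have h1 : G = Polynomial.nthRootsFinset G.card (1 : ℂ) := by
    refine Finset.eq_of_subset_of_card_le (fun g hg => ?_) hprim.card_nthRootsFinset.le
    exact (Polynomial.mem_nthRootsFinset hcard _).2 (hpow g hg)
  have h2 : ((Finset.range G.card).image fun k : ℕ =>
      Complex.exp (k * (2 * Real.pi * Complex.I / G.card))) =
      Polynomial.nthRootsFinset G.card (1 : ℂ) := by
    refine Finset.eq_of_subset_of_card_le (fun g hg => ?_) ?_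
    · obtain ⟨k, -, rfl⟩ := Finset.mem_image.1 hg
      rw [Polynomial.mem_nthRootsFinset hcard, hexp, pow_right_comm,
        hprim.pow_eq_one, one_pow]
    · rw [Finset.card_image_of_injOn, Finset.card_range, hprim.card_nthRootsFinset]
      intro i hi j hj hij
      simp only [hexp] at hij
      exact hprim.pow_inj (Finset.mem_range.1 hi) (Finset.mem_range.1 hj) hij
  exact h1.trans h2.symm

end Spectrum

/-! ### Peripheral spectrum of irreducible nonnegative matrices -/

section PerronFrobenius

variable {m : Type*} [Fintype m] [DecidableEq m]

theorem mulVec_mono_of_nonneg {l : Type*} [Fintype l] {M : Matrix l l ℝ} (hM : ∀ i j, 0 ≤ M i j)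
    {v w : l → ℝ} (h : v ≤ w) : M *ᵥ v ≤ M *ᵥ w := fun i =>
  Finset.sum_le_sum fun j _ => mul_le_mul_of_nonneg_left (h j) (hM i j)

/-- No nonempty proper set of vertices of the graph of `M` is closed under successors. -/
def StronglyConnected (M : Matrix m m ℝ) : Prop :=
  ∀ s : Set m, s.Nonempty → (∀ i j, i ∈ s → M i j ≠ 0 → j ∈ s) → s = Set.univ

/-- The summand `1` makes every coordinate nondecreasing in `n`, so positivity persists once
reached. The coordinates that never become positive are closed under successors; if there were any,
they would be all of them, forcing `w = 0`. -/
theorem StronglyConnected.eventually_pos {M : Matrix m m ℝ} (hM : ∀ i j, 0 ≤ M i j)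
    (hirr : StronglyConnected M) {w : m → ℝ} (hw : 0 ≤ w) (hw0 : w ≠ 0) :
    ∀ᶠ n : ℕ in atTop, ∀ i, 0 < (((1 + M) ^ n) *ᵥ w) i := by
  have hstep : ∀ n i, (((1 + M) ^ (n + 1)) *ᵥ w) i =
      (((1 + M) ^ n) *ᵥ w) i + (M *ᵥ (((1 + M) ^ n) *ᵥ w)) i := by
    intro n i
    rw [pow_succ', ← Matrix.mulVec_mulVec, Matrix.add_mulVec, Matrix.one_mulVec, Pi.add_apply]
  have hnn : ∀ n, 0 ≤ ((1 + M) ^ n) *ᵥ w := by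
    intro n
    induction n with
    | zero => simpa using hw
    | succ n ih =>
      intro i
      rw [hstep]
      exact add_nonneg (ih i) (Finset.sum_nonneg fun j _ => mul_nonneg (hM i j) (ih j))
  have hMnn : ∀ n i, 0 ≤ (M *ᵥ (((1 + M) ^ n) *ᵥ w)) i := fun n i =>
    Finset.sum_nonneg fun j _ => mul_nonneg (hM i j) (hnn n j)
  have hmono : ∀ i, Monotone fun n => (((1 + M) ^ n) *ᵥ w) i := fun i =>
    monotone_nat_of_le_succ fun n => by rw [hstep]; linarith [hMnn n i]
  have hex : ∀ i, ∃ n, 0 < (((1 + M) ^ n) *ᵥ w) i := by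
    by_contra! hcon
    have huniv := hirr {i | ∀ n, (((1 + M) ^ n) *ᵥ w) i ≤ 0} hcon (by
      intro i j hi hij n
      have h1 : (((1 + M) ^ (n + 1)) *ᵥ w) i ≤ 0 := hi (n + 1)
      rw [hstep] at h1
      have h2 : M i j * (((1 + M) ^ n) *ᵥ w) j ≤ (M *ᵥ (((1 + M) ^ n) *ᵥ w)) i :=
        Finset.single_le_sum (f := fun j => M i j * (((1 + M) ^ n) *ᵥ w) j)
          (fun k _ => mul_nonneg (hM i k) (hnn n k)) (Finset.mem_univ j)
      have h3 : 0 < M i j := lt_of_le_of_ne (hM i j) hij.symm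
      have h4 : 0 ≤ (((1 + M) ^ n) *ᵥ w) i := hnn n i
      by_contra! h5
      have := mul_pos h3 h5
      linarith)
    refine hw0 (le_antisymm (fun i => ?_) hw)
    have : i ∈ {i | ∀ n, (((1 + M) ^ n) *ᵥ w) i ≤ 0} := huniv ▸ Set.mem_univ i
    simpa using this 0
  refine eventually_all.2 fun i => ?_
  obtain ⟨N, hN⟩ := hex i
  filter_upwards [eventually_ge_atTop N] with n hn
  exact hN.trans_le (hmono i hn)

/-- A positive vector that is expanded by the factor `c` forces an eigenvalue of modulus `≥ c`. -/
theorem le_of_smul_le_mulVec [Nonempty m] {M : Matrix m m ℝ} (hM : ∀ i j, 0 ≤ M i j) {r c : ℝ}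
    (hr : 0 ≤ r) (hb : ∀ μ ∈ eigs M, ‖μ‖ ≤ r) {x : m → ℝ} (hx : ∀ i, 0 < x i)
    (h : c • x ≤ M *ᵥ x) : c ≤ r := by
  by_contra! hc
  obtain ⟨γ, hγ1, hγ2⟩ := exists_between hc
  have hγ0 : 0 < γ := hr.trans_lt hγ1
  have hc0 : 0 < c := hγ0.trans hγ2
  obtain ⟨B, -, hB⟩ := exists_abs_pow_apply_le M hr hb hγ1
  -- Iterating the inequality gives growth at least `c ^ n`, while the spectral bound allows at most
  -- `γ ^ n` for some `γ < c`.
  have hpow : ∀ n : ℕ, c ^ n • x ≤ (M ^ n) *ᵥ x := by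
    intro n
    induction n with
    | zero => simp
    | succ n ih =>
      calc c ^ (n + 1) • x = c ^ n • (c • x) := by rw [smul_smul, pow_succ]
        _ ≤ c ^ n • (M *ᵥ x) := smul_le_smul_of_nonneg_left h (by positivity)
        _ = M *ᵥ (c ^ n • x) := by rw [Matrix.mulVec_smul]
        _ ≤ M *ᵥ ((M ^ n) *ᵥ x) := mulVec_mono_of_nonneg hM ih
        _ = (M ^ (n + 1)) *ᵥ x := by rw [Matrix.mulVec_mulVec, pow_succ']
  obtain ⟨i⟩ := ‹Nonempty m›
  have hbound : ∀ n : ℕ, (c / γ) ^ n ≤ B * (∑ j, x j) / x i := by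
    intro n
    have h1 : c ^ n * x i ≤ B * γ ^ n * ∑ j, x j := by
      calc c ^ n * x i ≤ ((M ^ n) *ᵥ x) i := hpow n i
        _ ≤ ∑ j, B * γ ^ n * x j := Finset.sum_le_sum fun j _ =>
          mul_le_mul_of_nonneg_right ((le_abs_self _).trans (hB n i j)) (hx j).le
        _ = B * γ ^ n * ∑ j, x j := by rw [Finset.mul_sum]
    rw [div_pow, le_div_iff₀ (hx i), div_mul_eq_mul_div, div_le_iff₀ (by positivity)]
    linarith
  have htop := tendsto_pow_atTop_atTop_of_one_lt ((one_lt_div hγ0).2 hγ2)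
  obtain ⟨n, hn⟩ := (htop.eventually_gt_atTop (B * (∑ j, x j) / x i)).exists
  exact absurd (hbound n) (not_le.2 hn)

/-- A nonnegative subinvariant vector of an irreducible matrix is a positive eigenvector. -/
theorem StronglyConnected.mulVec_eq {M : Matrix m m ℝ} (hM : ∀ i j, 0 ≤ M i j)
    (hirr : StronglyConnected M) {r : ℝ} (hr : 0 ≤ r) (hb : ∀ μ ∈ eigs M, ‖μ‖ ≤ r) {y : m → ℝ}
    (hy : 0 ≤ y) (hy0 : y ≠ 0) (h : r • y ≤ M *ᵥ y) : M *ᵥ y = r • y ∧ ∀ i, 0 < y i := by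
  have hne : Nonempty m := by
    by_contra hcon
    rw [not_nonempty_iff] at hcon
    exact hy0 (Subsingleton.elim _ _)
  have heq : M *ᵥ y = r • y := by
    by_contra hz
    have hz0 : M *ᵥ y - r • y ≠ 0 := sub_ne_zero.2 hz
    -- Applying `(1 + M) ^ n`, which commutes with `M`, to `y` and to the nonzero defect makes both
    -- strictly positive. The smallest ratio `(M x)_i / x_i` then exceeds `r`, which the spectral
    -- bound forbids.
    obtain ⟨n, hn1, hn2⟩ := ((hirr.eventually_pos hM hy hy0).and
      (hirr.eventually_pos hM (sub_nonneg.2 h) hz0)).exists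
    set x := ((1 + M) ^ n) *ᵥ y with hx
    have hcomm : (1 + M) ^ n * M = M * (1 + M) ^ n :=
      (((Commute.one_left M).add_left (Commute.refl M)).pow_left n).eq
    have hgt : ∀ i, r * x i < (M *ᵥ x) i := by
      intro i
      have := hn2 i
      rw [Matrix.mulVec_sub, Matrix.mulVec_mulVec, hcomm, ← Matrix.mulVec_mulVec,
        Matrix.mulVec_smul, ← hx] at this
      simpa using this
    obtain ⟨i₀, hi₀⟩ := Finite.exists_min fun i => (M *ᵥ x) i / x i
    have hle : ((M *ᵥ x) i₀ / x i₀) • x ≤ M *ᵥ x := fun i => by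
      have := hi₀ i
      rw [le_div_iff₀ (hn1 i)] at this
      simpa using this
    have h1 := le_of_smul_le_mulVec hM hr hb hn1 hle
    have h2 : r < (M *ᵥ x) i₀ / x i₀ := (lt_div_iff₀ (hn1 i₀)).2 (hgt i₀)
    linarith
  refine ⟨heq, fun i => ?_⟩
  obtain ⟨n, hn⟩ := (hirr.eventually_pos hM hy hy0).exists
  have hpow : ((1 + M) ^ n) *ᵥ y = (1 + r) ^ n • y := by
    clear hn
    induction n with
    | zero => simp
    | succ n ih =>
      rw [pow_succ, ← Matrix.mulVec_mulVec, Matrix.add_mulVec, Matrix.one_mulVec, heq,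
        show y + r • y = (1 + r) • y by rw [add_smul, one_smul], Matrix.mulVec_smul, ih, smul_smul,
        pow_succ, mul_comm]
  have h1 := hn i
  rw [hpow, Pi.smul_apply, smul_eq_mul] at h1
  exact pos_of_mul_pos_right h1 (by positivity)

/-- Equality in the triangle inequality for a weighted sum of complex numbers of modulus one. -/
theorem eq_of_sum_mul_eq {l : Type*} [Fintype l] {p : l → ℝ} (hp : ∀ j, 0 ≤ p j) {u : l → ℂ}
    (hu : ∀ j, ‖u j‖ = 1) {w : ℂ} (hw : ‖w‖ = 1)
    (h : ∑ j, (p j : ℂ) * u j = (∑ j, (p j : ℂ)) * w) {j : l}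
    (hj : p j ≠ 0) : u j = w := by
  have hww : w * (starRingEnd ℂ) w = 1 := by
    rw [Complex.mul_conj, Complex.normSq_eq_norm_sq, hw]; simp
  have hre : ∀ j, (u j * (starRingEnd ℂ) w).re ≤ 1 := fun j =>
    (Complex.re_le_norm _).trans (by rw [norm_mul, hu, RCLike.norm_conj, hw, one_mul])
  -- After rotating `w` to `1`, the real parts show that a sum of nonnegative defects vanishes, so
  -- each defect does.
  have hsum : ∑ j, p j * (1 - (u j * (starRingEnd ℂ) w).re) = 0 := by
    have h1 : ∑ j, (p j : ℂ) * (u j * (starRingEnd ℂ) w) = ∑ j, (p j : ℂ) := by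
      simp_rw [← mul_assoc]
      rw [← Finset.sum_mul, h, mul_assoc, hww, mul_one]
    have h2 := congrArg Complex.re h1
    simp only [Complex.re_sum, Complex.re_ofReal_mul, Complex.ofReal_re] at h2
    simp_rw [mul_sub, mul_one]
    rw [Finset.sum_sub_distrib, h2, sub_self]
  have hz := (Finset.sum_eq_zero_iff_of_nonneg fun j _ =>
    mul_nonneg (hp j) (sub_nonneg.2 (hre j))).1 hsum j (Finset.mem_univ j)
  have h3 : (u j * (starRingEnd ℂ) w).re = 1 := by
    rcases mul_eq_zero.1 hz with h | h
    · exact absurd h hj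
    · linarith
  have hn : ‖u j * (starRingEnd ℂ) w‖ = 1 := by rw [norm_mul, hu, RCLike.norm_conj, hw, one_mul]
  have h4 : u j * (starRingEnd ℂ) w = 1 := by
    have him : (u j * (starRingEnd ℂ) w).im = 0 := by
      have := Complex.sq_norm (u j * (starRingEnd ℂ) w)
      rw [hn, Complex.normSq_apply, h3] at this
      nlinarith
    exact Complex.ext (by simpa using h3) (by simpa using him)
  calc u j = u j * (w * (starRingEnd ℂ) w) := by rw [hww, mul_one]
    _ = (u j * (starRingEnd ℂ) w) * w := by ring
    _ = w := by rw [h4, one_mul]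

/-- Substituting `zX` for `X` in the characteristic matrix of `z • A` gives `z` times that of `A`.
-/
theorem Matrix.roots_charpoly_smul (A : Matrix m m ℂ) {z : ℂ} (hz : z ≠ 0) :
    (z • A).charpoly.roots = A.charpoly.roots.map (z * ·) := by
  have hcomp : (z • A).charpoly.comp (Polynomial.C z * Polynomial.X + Polynomial.C 0) =
      Polynomial.C (z ^ Fintype.card m) * A.charpoly := by
    rw [Polynomial.C_0, add_zero, Matrix.charpoly, Matrix.charpoly,
      ← Polynomial.coe_compRingHom_apply, RingHom.map_det, Polynomial.C_pow, ← Matrix.det_smul]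
    congr 1
    ext i j : 1
    by_cases hij : i = j
    · subst hij
      simp [Matrix.charmatrix_apply_eq, mul_sub]
    · simp [Matrix.charmatrix_apply_ne _ _ _ hij]
  rw [← Polynomial.map_roots_comp_C_mul_X_add_C (z • A).charpoly z 0 (isUnit_iff_ne_zero.2 hz),
    hcomp, Polynomial.roots_C_mul _ (pow_ne_zero _ hz)]
  simp

/-- The spectrum of an irreducible nonnegative matrix is invariant under the rotations that carry
the spectral radius to another eigenvalue. -/
theorem StronglyConnected.eigs_map_mul {M : Matrix m m ℝ} (hM : ∀ i j, 0 ≤ M i j)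
    (hirr : StronglyConnected M) {r : ℝ} (hr : 0 < r) (hb : ∀ μ ∈ eigs M, ‖μ‖ ≤ r) {z : ℂ}
    (hz : ‖z‖ = 1) (hzr : z * r ∈ eigs M) : (eigs M).map (z * ·) = eigs M := by
  obtain ⟨v, hv0, hv⟩ := (mem_eigs_iff M _).1 hzr
  have hvi : ∀ i, ∑ j, (M i j : ℂ) * v j = z * r * v i := fun i => by
    simpa [Matrix.mulVec, dotProduct] using congrFun hv i
  set x : m → ℝ := fun i => ‖v i‖ with hx
  have hx0 : x ≠ 0 := fun h => hv0 (funext fun i => norm_eq_zero.1 (congrFun h i))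
  -- By the triangle inequality the moduli of an eigenvector are subinvariant, hence form a positive
  -- eigenvector for `r`. All the triangle inequalities are then equalities, so the phases `u` turn
  -- by exactly `z` along each edge.
  have hsub : r • x ≤ M *ᵥ x := fun i => by
    calc r * ‖v i‖ = ‖∑ j, (M i j : ℂ) * v j‖ := by
          rw [hvi, norm_mul, norm_mul, hz, one_mul, Complex.norm_of_nonneg hr.le]
      _ ≤ ∑ j, ‖(M i j : ℂ) * v j‖ := norm_sum_le _ _
      _ = (M *ᵥ x) i := by
          refine Finset.sum_congr rfl fun j _ => ?_
          rw [norm_mul, Complex.norm_of_nonneg (hM i j)]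
  obtain ⟨heq, hpos⟩ := hirr.mulVec_eq hM hr.le hb (fun i => norm_nonneg (v i)) hx0 hsub
  have hxi : ∀ i, ∑ j, (M i j : ℂ) * (x j : ℂ) = r * x i := fun i => by
    have := congrFun heq i
    simp only [Matrix.mulVec, dotProduct, Pi.smul_apply, smul_eq_mul] at this
    exact_mod_cast this
  set u : m → ℂ := fun i => v i / x i with hu
  have hxne : ∀ i, (x i : ℂ) ≠ 0 := fun i => Complex.ofReal_ne_zero.2 (hpos i).ne'
  have hu1 : ∀ i, ‖u i‖ = 1 := fun i => by
    rw [hu, norm_div, Complex.norm_of_nonneg (hpos i).le]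
    exact div_self (hpos i).ne'
  have hvu : ∀ i, v i = x i * u i := fun i => by rw [hu]; field_simp [hxne i]
  have hu0 : ∀ i, u i ≠ 0 := fun i => norm_ne_zero_iff.1 (by rw [hu1]; exact one_ne_zero)
  have hedge : ∀ i j, M i j ≠ 0 → u j = z * u i := by
    intro i j hij
    refine eq_of_sum_mul_eq (p := fun j => M i j * x j)
      (fun j => mul_nonneg (hM i j) (hpos j).le) hu1 (by rw [norm_mul, hz, hu1, one_mul]) ?_
      (mul_ne_zero hij (hpos j).ne')
    push_cast
    rw [hxi]
    calc ∑ j, (M i j : ℂ) * x j * u j = ∑ j, (M i j : ℂ) * v j := by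
          simp_rw [hvu, mul_assoc]
      _ = r * x i * (z * u i) := by rw [hvi, hvu]; ring
  have hz0 : z ≠ 0 := norm_ne_zero_iff.1 (by rw [hz]; exact one_ne_zero)
  have hdet : IsUnit (Matrix.diagonal u) := by
    rw [Matrix.isUnit_iff_isUnit_det, Matrix.det_diagonal]
    exact isUnit_iff_ne_zero.2 (Finset.prod_ne_zero_iff.2 fun i _ => hu0 i)
  obtain ⟨U, hU⟩ := hdet
  -- Conjugating by the diagonal matrix of phases multiplies each nonzero entry by `u j / u i = z`.
  have hconj : U⁻¹.val * M.map Complex.ofReal * U.val = z • M.map Complex.ofReal := by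
    have hMU : M.map Complex.ofReal * U.val = U.val * (z • M.map Complex.ofReal) := by
      rw [hU]
      ext i j
      rw [Matrix.mul_diagonal, Matrix.diagonal_mul, Matrix.smul_apply, Matrix.map_apply]
      by_cases hij : M i j = 0
      · simp [hij]
      · rw [hedge i j hij, smul_eq_mul]; ring
    rw [mul_assoc, hMU, ← mul_assoc, Units.inv_mul, one_mul]
  rw [eigs, ← Matrix.roots_charpoly_smul _ hz0, ← hconj,
    Matrix.coe_units_inv, Matrix.charpoly_units_conj']

open Classical in
/-- The eigenvalues of modulus `r`, the spectral radius, of a nonnegative matrix, counted with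
multiplicity, form a union of families of all rotations of `r` by roots of unity of some order. -/
theorem StronglyConnected.exists_periods {M : Matrix m m ℝ} (hM : ∀ i j, 0 ≤ M i j)
    (hirr : StronglyConnected M) {r : ℝ} (hr : 0 < r) (hb : ∀ μ ∈ eigs M, ‖μ‖ ≤ r) :
    ∃ hs : Multiset ℕ, (∀ h ∈ hs, 1 ≤ h) ∧
      (eigs M).filter (fun μ => ‖μ‖ = r) =
        hs.bind fun h => (Multiset.range h).map fun k : ℕ =>
          Complex.exp (k * (2 * Real.pi * Complex.I / h)) * (r : ℂ) := by
  set F := (eigs M).filter (fun μ => ‖μ‖ = r) with hF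
  have hr0 : (r : ℂ) ≠ 0 := Complex.ofReal_ne_zero.2 hr.ne'
  by_cases hF0 : F = 0
  -- The number `r` is only an upper bound and need not be attained; then there are no periods.
  · exact ⟨0, by simp, by simp [hF0]⟩
  set G : Finset ℂ := F.toFinset.image (· / (r : ℂ)) with hG
  have hmem : ∀ z : ℂ, z ∈ G ↔ ‖z‖ = 1 ∧ z * r ∈ eigs M := by
    intro z
    simp only [hG, hF, Finset.mem_image, Multiset.mem_toFinset, Multiset.mem_filter]
    constructor
    · rintro ⟨μ, ⟨h1, h2⟩, rfl⟩
      exact ⟨by rw [norm_div, h2, Complex.norm_of_nonneg hr.le, div_self hr.ne'],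
        by rwa [div_mul_cancel₀ _ hr0]⟩
    · rintro ⟨h1, h2⟩
      exact ⟨z * r, ⟨h2, by rw [norm_mul, h1, one_mul, Complex.norm_of_nonneg hr.le]⟩,
        mul_div_cancel_right₀ _ hr0⟩
  have hrot : ∀ z ∈ G, (eigs M).map (z * ·) = eigs M := fun z hz =>
    hirr.eigs_map_mul hM hr hb ((hmem z).1 hz).1 ((hmem z).1 hz).2
  have hne : G.Nonempty := by
    rw [hG, Finset.image_nonempty, Multiset.toFinset_nonempty]
    exact hF0
  have h0 : (0 : ℂ) ∉ G := fun h => by simpa using ((hmem 0).1 h).1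
  have hmul : ∀ x ∈ G, ∀ y ∈ G, x * y ∈ G := by
    intro x hx y hy
    refine (hmem _).2 ⟨by rw [norm_mul, ((hmem x).1 hx).1, ((hmem y).1 hy).1, one_mul], ?_⟩
    rw [← hrot x hx, mul_assoc]
    exact Multiset.mem_map_of_mem _ ((hmem y).1 hy).2
  have hroots := G.eq_image_exp_of_mul_mem hne h0 hmul
  -- Rotation invariance gives each peripheral eigenvalue the multiplicity of `r`, so the family of
  -- `|G|`-th roots of unity is repeated that many times.
  refine ⟨Multiset.replicate ((eigs M).count (r : ℂ)) G.card, fun h hh => ?_, ?_⟩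
  · rw [Multiset.eq_of_mem_replicate hh]; exact hne.card_pos
  have hinj : Function.Injective fun x : ℂ => x * (r : ℂ) := mul_left_injective₀ hr0
  have hmap : ((Multiset.range G.card).map fun k : ℕ =>
      Complex.exp (k * (2 * Real.pi * Complex.I / G.card)) * (r : ℂ)) =
      G.val.map (· * (r : ℂ)) := by
    have hprim := Complex.isPrimitiveRoot_exp G.card hne.card_pos.ne'
    conv_rhs => rw [hroots]
    rw [Finset.image_val_of_injOn, Multiset.map_map]
    · rfl
    · intro i hi j hj hij
      simp only [Complex.exp_nat_mul] at hij
      exact hprim.pow_inj (Finset.mem_range.1 hi) (Finset.mem_range.1 hj) hij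
  ext μ
  rw [Multiset.count_bind, Multiset.map_replicate, Multiset.sum_replicate, hmap, smul_eq_mul, hF]
  obtain ⟨z, rfl⟩ : ∃ z : ℂ, μ = z * r := ⟨μ / r, (div_mul_cancel₀ _ hr0).symm⟩
  rw [Multiset.count_map_eq_count' _ _ hinj]
  by_cases hz : z ∈ G
  · have hz1 := (hmem z).1 hz
    have hz0 : z ≠ 0 := fun h => h0 (h ▸ hz)
    rw [Multiset.count_filter_of_pos
        (by rw [norm_mul, hz1.1, one_mul, Complex.norm_of_nonneg hr.le]),
      Multiset.count_eq_one_of_mem G.nodup hz, mul_one]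
    conv_lhs => rw [← hrot z hz]
    exact Multiset.count_map_eq_count' _ _ (mul_right_injective₀ hz0) _
  · rw [Multiset.count_eq_zero_of_notMem (s := G.val) hz, mul_zero, Multiset.count_eq_zero,
      Multiset.mem_filter]
    rintro ⟨h1, h2⟩
    refine hz ((hmem z).2 ⟨?_, h1⟩)
    rw [norm_mul, Complex.norm_of_nonneg hr.le] at h2
    exact (mul_eq_right₀ hr.ne').1 h2

/-! ### Reducible matrices and existence of periods -/

/-- A set of vertices closed under successors makes the matrix block triangular, so the
characteristic polynomial factors. -/
theorem eigs_eq_add_of_closed (M : Matrix m m ℝ) (p : m → Prop) [DecidablePred p]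
    (h : ∀ i, p i → ∀ j, ¬p j → M i j = 0) :
    eigs M = eigs (M.toSquareBlockProp p) + eigs (M.toSquareBlockProp fun i => ¬p i) := by
  have hdet : (M.map Complex.ofReal).charpoly =
      ((M.toSquareBlockProp p).map Complex.ofReal).charpoly *
        ((M.toSquareBlockProp fun i => ¬p i).map Complex.ofReal).charpoly := by
    rw [Matrix.charpoly, Matrix.twoBlockTriangular_det' _ p]
    · congr 1 <;>
      · rw [Matrix.charpoly]
        congr 1
        ext i j : 1
        by_cases hij : i = j
        · subst hij
          simp [Matrix.toSquareBlockProp_def, Matrix.charmatrix_apply_eq]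
        · have hij' : (i : m) ≠ j := fun h => hij (Subtype.ext h)
          simp [Matrix.toSquareBlockProp_def, Matrix.charmatrix_apply_ne _ _ _ hij,
            Matrix.charmatrix_apply_ne _ _ _ hij']
    · intro i hi j hj
      have hij : i ≠ j := fun e => hj (e ▸ hi)
      rw [Matrix.charmatrix_apply_ne _ _ _ hij]
      simp [h i hi j hj]
  rw [eigs, hdet, Polynomial.roots_mul (mul_ne_zero (Matrix.charpoly_monic _).ne_zero
    (Matrix.charpoly_monic _).ne_zero)]
  rfl

end PerronFrobenius

open Classical in
/-- The structure of the peripheral spectrum, by induction on the number of strong components. -/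
theorem exists_periods_of_card {r : ℝ} (hr : 0 < r) (N : ℕ) :
    ∀ {m : Type*} [Fintype m] [DecidableEq m] (M : Matrix m m ℝ), Fintype.card m ≤ N →
      (∀ i j, 0 ≤ M i j) → (∀ μ ∈ eigs M, ‖μ‖ ≤ r) →
      ∃ hs : Multiset ℕ, (∀ h ∈ hs, 1 ≤ h) ∧
        (eigs M).filter (fun μ => ‖μ‖ = r) =
          hs.bind fun h => (Multiset.range h).map fun k : ℕ =>
            Complex.exp (k * (2 * Real.pi * Complex.I / h)) * (r : ℂ) := by
  induction N with
  | zero =>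
    intro m _ _ M hcard hM hb
    have : IsEmpty m := Fintype.card_eq_zero_iff.1 (Nat.le_zero.1 hcard)
    exact StronglyConnected.exists_periods hM
      (fun s hs _ => (hs.ne_empty (Set.eq_empty_of_isEmpty s)).elim) hr hb
  | succ N ih =>
    intro m _ _ M hcard hM hb
    by_cases hirr : StronglyConnected M
    · exact hirr.exists_periods hM hr hb
    · simp only [StronglyConnected, not_forall] at hirr
      -- A closed proper subset splits the matrix into two smaller blocks. The same `r` bounds both,
      -- though a block may fail to attain it; this is why the induction assumes only an upper
      -- bound.
      obtain ⟨s, ⟨x, hx⟩, hclosed, hs⟩ := hirr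
      obtain ⟨y, hy⟩ := (Set.ne_univ_iff_exists_notMem s).1 hs
      have hadd := eigs_eq_add_of_closed M (· ∈ s) fun i hi j hj => by
        by_contra hij
        exact hj (hclosed i j hi hij)
      have hc1 : Fintype.card {i // i ∈ s} ≤ N := by
        have := Fintype.card_subtype_lt (p := (· ∈ s)) hy
        omega
      have hc2 : Fintype.card {i // ¬ i ∈ s} ≤ N := by
        have := Fintype.card_subtype_lt (p := fun i => ¬ i ∈ s) (x := x) (by simpa using hx)
        omega
      obtain ⟨hs1, h11, h12⟩ := ih (M.toSquareBlockProp (· ∈ s)) hc1 (fun i j => hM i j)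
        fun μ hμ => hb μ (hadd ▸ Multiset.mem_add.2 (Or.inl hμ))
      obtain ⟨hs2, h21, h22⟩ := ih (M.toSquareBlockProp fun i => ¬ i ∈ s) hc2 (fun i j => hM i j)
        fun μ hμ => hb μ (hadd ▸ Multiset.mem_add.2 (Or.inr hμ))
      refine ⟨hs1 + hs2, fun h hh => ?_, ?_⟩
      · rcases Multiset.mem_add.1 hh with hh | hh
        · exact h11 h hh
        · exact h21 h hh
      · rw [hadd, Multiset.filter_add, h12, h22, Multiset.add_bind]

section PerronFrobenius

variable {m : Type*} [Fintype m] [DecidableEq m]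

open Classical in
-- Each period contributes `r` once, through `k = 0`; hence the number of periods is the
-- multiplicity of the Perron–Frobenius eigenvalue.
theorem count_map_exp_mul {h : ℕ} (hh : 1 ≤ h) {r : ℝ} (hr : r ≠ 0) :
    ((Multiset.range h).map fun k : ℕ =>
      Complex.exp (k * (2 * Real.pi * Complex.I / h)) * (r : ℂ)).count (r : ℂ) = 1 := by
  have hprim := Complex.isPrimitiveRoot_exp h (Nat.one_le_iff_ne_zero.1 hh)
  refine Multiset.count_eq_one_of_mem ((Multiset.nodup_range h).map_on ?_)
    (Multiset.mem_map.2 ⟨0, Multiset.mem_range.2 hh, by simp⟩)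
  intro i hi j hj hij
  have h1 := mul_right_cancel₀ (Complex.ofReal_ne_zero.2 hr) hij
  simp only [Complex.exp_nat_mul] at h1
  exact hprim.pow_inj (Multiset.mem_range.1 hi) (Multiset.mem_range.1 hj) h1

/-- The periodic families of eigenvalues, indexed by complex rather than natural exponents. -/
theorem range_bind_pure_cast (hs : Multiset ℕ) (r : ℝ) :
    (hs.bind fun h => (Multiset.range h).map fun k =>
      Complex.exp (k * (2 * Real.pi * Complex.I / h)) * (r : ℂ)) =
    hs.bind fun h => (Multiset.range h).map fun k : ℕ =>
      Complex.exp (k * (2 * Real.pi * Complex.I / h)) * (r : ℂ) := by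
  refine Multiset.bind_congr fun h _ => ?_
  -- On the left, `Multiset.range h` has been coerced to a multiset of complex numbers through the
  -- monad operations, which are unfolded here.
  simp [Multiset.bind_def, Multiset.pure_def, Multiset.bind_singleton, Multiset.map_map]

/-- A nonnegative matrix has a Perron-Frobenius eigenvalue and a multiset of periods. -/
theorem exists_isPFEigenvalue_isPeriods [Nonempty m] {M : Matrix m m ℝ} (hM : ∀ i j, 0 ≤ M i j) :
    ∃ (lam : ℝ) (hs : Multiset ℕ), IsPFEigenvalue M lam ∧ IsPeriods M lam hs := by
  classical
  have hcard : Multiset.card (eigs M) = Fintype.card m := by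
    rw [eigs, ← (IsAlgClosed.splits _).natDegree_eq_card_roots, Matrix.charpoly_natDegree_eq_dim]
  have hne : (eigs M).toFinset.Nonempty := by
    rw [Multiset.toFinset_nonempty, ← Multiset.card_pos, hcard]
    exact Fintype.card_pos
  obtain ⟨μ₀, hμ₀, hmax⟩ := (eigs M).toFinset.exists_max_image (fun μ => ‖μ‖) hne
  rw [Multiset.mem_toFinset] at hμ₀
  have hb : ∀ μ ∈ eigs M, ‖μ‖ ≤ ‖μ₀‖ := fun μ hμ => hmax μ (Multiset.mem_toFinset.2 hμ)
  rcases (norm_nonneg μ₀).eq_or_lt with h0 | hpos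
  · have hall : ∀ μ ∈ eigs M, μ = 0 := fun μ hμ => norm_le_zero_iff.1 (h0 ▸ hb μ hμ)
    have hrep := Multiset.eq_replicate_card.2 hall
    -- In the nilpotent case all periods are `1`, each accounting for one eigenvalue `0`.
    refine ⟨0, Multiset.replicate (Fintype.card m) 1, ⟨le_rfl, ?_, ?_⟩, ?_, ?_, ?_⟩
    · simpa [hall μ₀ hμ₀] using hμ₀
    · intro μ hμ; simp [hall μ hμ]
    · rw [hrep, hcard]; simp
    · intro h hh; exact (Multiset.eq_of_mem_replicate hh).ge
    · rw [Multiset.filter_eq_self.2 fun μ hμ => by simp [hall μ hμ], hrep, hcard]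
      rw [range_bind_pure_cast, Multiset.bind_congr (g := fun _ => {(0 : ℂ)}) fun h hh => by
        rw [Multiset.eq_of_mem_replicate hh]; simp]
      simp [Multiset.bind_singleton]
  · obtain ⟨hs, h1, h2⟩ := exists_periods_of_card hpos _ M le_rfl hM hb
    have hcount : (eigs M).count ((‖μ₀‖ : ℝ) : ℂ) = Multiset.card hs := by
      rw [← Multiset.count_filter_of_pos (p := fun μ => ‖μ‖ = ‖μ₀‖) (by simp), h2,
        Multiset.count_bind, Multiset.map_congr (g := fun _ => 1) rfl
          fun h hh => count_map_exp_mul (h1 h hh) hpos.ne']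
      simp
    -- The maximal modulus is itself an eigenvalue: `μ₀` lies in some periodic family, and every
    -- family contains the modulus.
    have hmem : ((‖μ₀‖ : ℝ) : ℂ) ∈ eigs M := by
      rw [← Multiset.count_pos, hcount, Multiset.card_pos]
      rintro rfl
      have : μ₀ ∈ (eigs M).filter (fun μ => ‖μ‖ = ‖μ₀‖) := Multiset.mem_filter.2 ⟨hμ₀, rfl⟩
      rw [h2] at this
      simp at this
    refine ⟨‖μ₀‖, hs, ⟨hpos.le, hmem, hb⟩, hcount.symm, h1, ?_⟩
    rw [range_bind_pure_cast]
    exact h2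

end PerronFrobenius

/-! ### Fitting decomposition and Rothblum's polynomial expansion -/

section Expansion

variable {m : Type*} [Fintype m] [DecidableEq m]

/-- The polynomial with value `n.choose j` at the natural number `n`. -/
noncomputable def choosePoly (j : ℕ) : ℝ[X] :=
  Polynomial.C ((j.factorial : ℝ)⁻¹) * descPochhammer ℝ j

theorem choosePoly_eval (j n : ℕ) : (choosePoly j).eval (n : ℝ) = n.choose j := by
  rw [choosePoly, Polynomial.eval_mul, Polynomial.eval_C, descPochhammer_eval_eq_descFactorial,
    Nat.descFactorial_eq_factorial_mul_choose, Nat.cast_mul,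
    inv_mul_cancel_left₀ (Nat.cast_ne_zero.2 j.factorial_ne_zero)]

theorem choosePoly_natDegree (j : ℕ) : (choosePoly j).natDegree = j := by
  rw [choosePoly, Polynomial.natDegree_C_mul (inv_ne_zero (Nat.cast_ne_zero.2 j.factorial_ne_zero)),
    descPochhammer_natDegree]

theorem tendsto_choose_div_pow_of_lt {j k : ℕ} (h : j < k) :
    Tendsto (fun n : ℕ => (n.choose j : ℝ) / (n : ℝ) ^ k) atTop (nhds 0) := by
  have h1 := Polynomial.div_tendsto_atTop_zero_of_degree_lt (choosePoly j)
      (Polynomial.X ^ k : ℝ[X]) (by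
    rw [Polynomial.degree_X_pow]
    refine Polynomial.degree_le_natDegree.trans_lt ?_
    rw [choosePoly_natDegree]
    exact_mod_cast h)
  simpa [choosePoly_eval, Function.comp_def] using h1.comp tendsto_natCast_atTop_atTop

theorem tendsto_choose_div_pow (k : ℕ) :
    Tendsto (fun n : ℕ => (n.choose k : ℝ) / (n : ℝ) ^ k) atTop (nhds (k.factorial : ℝ)⁻¹) := by
  have hne : choosePoly k ≠ 0 := fun h => by
    simpa [choosePoly_eval] using congrArg (Polynomial.eval (k : ℝ)) h
  have h1 := Polynomial.div_tendsto_atTop_leadingCoeff_div_of_degree_eq (choosePoly k)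
    (Polynomial.X ^ k : ℝ[X]) (by
      rw [Polynomial.degree_X_pow, Polynomial.degree_eq_natDegree hne, choosePoly_natDegree])
  have hl : (choosePoly k).leadingCoeff = (k.factorial : ℝ)⁻¹ := by
    rw [choosePoly, Polynomial.leadingCoeff_mul, Polynomial.leadingCoeff_C,
      (monic_descPochhammer ℝ k).leadingCoeff, mul_one]
  rw [hl] at h1
  simpa [choosePoly_eval, Function.comp_def] using h1.comp tendsto_natCast_atTop_atTop

theorem Commute.aeval_right_of_commute {T f : Matrix m m ℝ} (h : Commute T f) (p : ℝ[X]) :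
    Commute T (Polynomial.aeval f p) := by
  induction p using Polynomial.induction_on' with
  | add p q hp hq => rw [map_add]; exact hp.add_right hq
  | monomial n a =>
    rw [Polynomial.aeval_monomial]
    exact (Algebra.commute_algebraMap_right a T).mul_right (h.pow_right n)

/-- The Fitting decomposition of a matrix `f`: the idempotent `E` projects onto the part where `f`
is nilpotent, along the part where it is invertible. -/
theorem exists_fitting_idempotent (f : Matrix m m ℝ) :
    ∃ (k : ℕ) (E G : Matrix m m ℝ), (∀ T, Commute T f → Commute T E) ∧ E * E = E ∧
      f ^ k * E = 0 ∧ (∀ j, f ^ j * E = 0 → k ≤ j) ∧ 1 - E = G * f := by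
  classical
  obtain ⟨q, hq, hdvd⟩ := Polynomial.exists_eq_pow_rootMultiplicity_mul_and_not_dvd f.charpoly
    f.charpoly_monic.ne_zero 0
  set n := f.charpoly.rootMultiplicity 0
  rw [Polynomial.C_0, sub_zero] at hq hdvd
  -- The exponent `n + 1` rather than `n` leaves a factor `f` in `1 - E` even when `n = 0`, that is,
  -- when `f` is invertible.
  obtain ⟨a, b, hab⟩ : IsCoprime ((Polynomial.X : ℝ[X]) ^ (n + 1)) q :=
    ((Polynomial.irreducible_X.coprime_iff_not_dvd).2 hdvd).pow_left
  set E := Polynomial.aeval f (b * q) with hE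
  have h1E : 1 - E = Polynomial.aeval f (a * Polynomial.X ^ (n + 1)) := by
    rw [sub_eq_iff_eq_add, hE, ← map_add, hab, map_one]
  have hn : f ^ n * E = 0 := by
    have : (Polynomial.X : ℝ[X]) ^ n * (b * q) = b * f.charpoly := by rw [hq]; ring
    calc f ^ n * E = Polynomial.aeval f ((Polynomial.X : ℝ[X]) ^ n * (b * q)) := by
          rw [map_mul _ (Polynomial.X ^ n), map_pow, Polynomial.aeval_X]
      _ = 0 := by rw [this, map_mul, Matrix.aeval_self_charpoly, mul_zero]
  have hEE : E * (1 - E) = 0 := by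
    have : (b * q) * (a * (Polynomial.X : ℝ[X]) ^ (n + 1)) = a * b * Polynomial.X * f.charpoly := by
      rw [hq]; ring
    rw [h1E, hE, ← map_mul, this, map_mul, Matrix.aeval_self_charpoly, mul_zero]
  have hex : ∃ k, f ^ k * E = 0 := ⟨n, hn⟩
  refine ⟨Nat.find hex, E, Polynomial.aeval f (a * Polynomial.X ^ n),
    fun T hT => hT.aeval_right_of_commute _, ?_, Nat.find_spec hex,
    fun j hj => Nat.find_min' hex hj, ?_⟩
  · rw [mul_sub, mul_one, sub_eq_zero] at hEE
    exact hEE.symm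
  · rw [h1E, pow_succ, ← mul_assoc, map_mul, Polynomial.aeval_X]

theorem map_ofReal_mul (A B : Matrix m m ℝ) :
    (A * B).map Complex.ofReal = A.map Complex.ofReal * B.map Complex.ofReal :=
  map_mul (Complex.ofRealHom.mapMatrix (m := m)) A B

theorem map_ofReal_sub (A B : Matrix m m ℝ) :
    (A - B).map Complex.ofReal = A.map Complex.ofReal - B.map Complex.ofReal :=
  map_sub (Complex.ofRealHom.mapMatrix (m := m)) A B

theorem map_ofReal_one : (1 : Matrix m m ℝ).map Complex.ofReal = 1 :=
  map_one (Complex.ofRealHom.mapMatrix (m := m))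

/-- Removing the generalized eigenspaces of the `h`-th roots of unity from `T`. -/
theorem eigs_mul_one_sub {T E G : Matrix m m ℝ} {h : ℕ} (hcomm : Commute T E) (hE : E * E = E)
    (hG : 1 - E = G * (T ^ h - 1)) {μ : ℂ} (hμ : μ ∈ eigs (T * (1 - E))) (hμ0 : μ ≠ 0) :
    μ ∈ eigs T ∧ μ ^ h ≠ 1 := by
  obtain ⟨v, hv0, hv⟩ := (mem_eigs_iff _ _).1 hμ
  have hEv : E.map Complex.ofReal *ᵥ v = 0 := by
    have h1 : E * (T * (1 - E)) = 0 := by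
      rw [← mul_assoc, ← hcomm.eq, mul_assoc, mul_sub, mul_one, hE, sub_self, mul_zero]
    have h2 : E.map Complex.ofReal *ᵥ (μ • v) = 0 := by
      rw [← hv, Matrix.mulVec_mulVec, ← map_ofReal_mul, h1]
      simp [Matrix.zero_mulVec]
    rw [Matrix.mulVec_smul] at h2
    exact (smul_eq_zero.1 h2).resolve_left hμ0
  have h1Ev : (1 - E).map Complex.ofReal *ᵥ v = v := by
    rw [map_ofReal_sub, map_ofReal_one, Matrix.sub_mulVec, hEv, Matrix.one_mulVec, sub_zero]
  have hTv : T.map Complex.ofReal *ᵥ v = μ • v := by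
    rw [← hv, map_ofReal_mul, ← Matrix.mulVec_mulVec, h1Ev]
  refine ⟨(mem_eigs_iff _ _).2 ⟨v, hv0, hTv⟩, fun hμh => hv0 ?_⟩
  have hpow : ∀ n : ℕ, (T ^ n).map Complex.ofReal *ᵥ v = μ ^ n • v := by
    intro n
    induction n with
    | zero => rw [pow_zero, map_ofReal_one, Matrix.one_mulVec, pow_zero, one_smul]
    | succ n ih =>
      rw [pow_succ, map_ofReal_mul, ← Matrix.mulVec_mulVec, hTv, Matrix.mulVec_smul, ih, smul_smul,
        pow_succ, mul_comm]
  rw [← h1Ev, hG, map_ofReal_mul, ← Matrix.mulVec_mulVec, map_ofReal_sub, map_ofReal_one,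
    Matrix.sub_mulVec, hpow, hμh, one_smul, Matrix.one_mulVec, sub_self, Matrix.mulVec_zero]

/-- The binomial expansion is cut at `k` by nilpotency. The range no longer depends on `n`, since
superfluous binomial coefficients vanish; this is what makes the result polynomial in `n`. -/
theorem one_add_pow_mul_eq_sum {f E : Matrix m m ℝ} {k : ℕ} (hk : f ^ k * E = 0) (n : ℕ) :
    (1 + f) ^ n * E = ∑ j ∈ Finset.range k, (n.choose j : ℝ) • (f ^ j * E) := by
  have hz : ∀ j, k ≤ j → f ^ j * E = 0 := fun j hj => by
    rw [← Nat.sub_add_cancel hj, pow_add, mul_assoc, hk, mul_zero]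
  have h1 : (1 + f) ^ n * E = ∑ j ∈ Finset.range (n + 1), (n.choose j : ℝ) • (f ^ j * E) := by
    rw [add_comm, (Commute.one_right f).add_pow, Finset.sum_mul]
    refine Finset.sum_congr rfl fun j _ => ?_
    rw [one_pow, mul_one, ← Nat.cast_comm, mul_assoc, ← nsmul_eq_mul, Nat.cast_smul_eq_nsmul]
  have h2 : ∀ N, n + 1 ≤ N → k ≤ N →
      ∑ j ∈ Finset.range (n + 1), (n.choose j : ℝ) • (f ^ j * E) =
        ∑ j ∈ Finset.range k, (n.choose j : ℝ) • (f ^ j * E) := by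
    intro N hN1 hN2
    rw [Finset.sum_subset (Finset.range_mono hN1), Finset.sum_subset (Finset.range_mono hN2)]
    · intro j _ hj
      rw [hz j (by simpa using hj), smul_zero]
    · intro j _ hj
      rw [Nat.choose_eq_zero_of_lt (by simpa using hj), Nat.cast_zero, zero_smul]
  rw [h1, h2 (max (n + 1) k) (le_max_left _ _) (le_max_right _ _)]

theorem pow_mul_eq_sum {T E : Matrix m m ℝ} {h k : ℕ} (hcomm : Commute T E)
    (hk : (T ^ h - 1) ^ k * E = 0) (n i : ℕ) :
    T ^ (h * n + i) * E =
      ∑ j ∈ Finset.range k, (n.choose j : ℝ) • ((T ^ h - 1) ^ j * E * T ^ i) := by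
  rw [pow_add, pow_mul, mul_assoc, (hcomm.pow_left i).eq, ← mul_assoc,
    show T ^ h = 1 + (T ^ h - 1) by abel, one_add_pow_mul_eq_sum (by simpa using hk),
    Finset.sum_mul]
  simp only [add_sub_cancel_left, smul_mul_assoc]

/-- The range of `W` lies in the generalized eigenspace of `lam`, where the power `jordanIndex`
already vanishes. -/
theorem sub_one_pow_jordanIndex_mul_eq_zero {M W : Matrix m m ℝ} {lam : ℝ} (hlam : lam ≠ 0) {k : ℕ}
    (h : (lam⁻¹ • M - 1) ^ k * W = 0) : (lam⁻¹ • M - 1) ^ jordanIndex M lam * W = 0 := by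
  have hlin : ∀ n : ℕ, (Matrix.toLin' M - lam • 1) ^ n =
      lam ^ n • Matrix.toLin' ((lam⁻¹ • M - 1) ^ n) := by
    intro n
    rw [Matrix.toLin'_pow, ← smul_pow, map_sub, map_smul, Matrix.toLin'_one, smul_sub, smul_smul,
      mul_inv_cancel₀ hlam, one_smul]
    rfl
  have hmem : ∀ (n : ℕ) (w : m → ℝ), W *ᵥ w ∈ Module.End.genEigenspace (Matrix.toLin' M) lam n ↔
      ((lam⁻¹ • M - 1) ^ n * W) *ᵥ w = 0 := by
    intro n w
    rw [Module.End.mem_genEigenspace_nat, LinearMap.mem_ker, hlin, LinearMap.smul_apply,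
      smul_eq_zero_iff_right (pow_ne_zero n hlam), Matrix.toLin'_apply, Matrix.mulVec_mulVec]
  apply Matrix.toLin'.injective
  refine LinearMap.ext fun w => ?_
  rw [Matrix.toLin'_apply, map_zero, LinearMap.zero_apply, ← hmem, jordanIndex,
    ← Module.End.maxGenEigenspace_eq]
  exact Module.End.genEigenspace_le_maximal (Matrix.toLin' M) lam k
    ((hmem k w).2 (by rw [h, Matrix.zero_mulVec]))

/-- For nonnegative `T`, the nilpotency index of `T ^ h - 1` on the range of `E` is at most that of
`T - 1` on its generalized eigenspace. -/
theorem exists_sub_one_pow_mul_ne_zero {T E : Matrix m m ℝ} (hT : ∀ i j, 0 ≤ T i j) {h k : ℕ}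
    (hh : 1 ≤ h) (hcomm : Commute T E) (hk : (T ^ h - 1) ^ (k + 1) * E = 0)
    (hk' : (T ^ h - 1) ^ k * E ≠ 0)
    (herr : ∀ a b, Tendsto (fun n : ℕ => (T ^ n * (1 - E) : Matrix m m ℝ) a b) atTop (nhds 0)) :
    ∃ W, (T - 1) ^ (k + 1) * W = 0 ∧ (T - 1) ^ k * W ≠ 0 := by
  set f := T ^ h - 1 with hf
  set g := ∑ i ∈ Finset.range h, T ^ i with hg
  set L := f ^ k * E with hL
  have hTf : Commute T f := (Commute.refl T).pow_right h |>.sub_right (Commute.one_right T)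
  have hTL : Commute T L := (hTf.pow_right k).mul_right hcomm
  have hgT : (T - 1) * g = f := mul_geom_sum T h
  have hTg : Commute T g := Commute.sum_right _ _ _ fun i _ => (Commute.refl T).pow_right i
  -- Up to the factor `1 / k!`, this is the limit of the nonnegative entries of `T ^ (h * n + i)`
  -- divided by `n ^ k`.
  have hpos : ∀ i a b, 0 ≤ (L * T ^ i) a b := by
    intro i a b
    have hexp : ∀ n : ℕ, (T ^ (h * n + i)) a b =
        ∑ j ∈ Finset.range (k + 1), (n.choose j : ℝ) * (f ^ j * E * T ^ i) a b +
          (T ^ (h * n + i) * (1 - E)) a b := by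
      intro n
      have h2 : T ^ (h * n + i) = T ^ (h * n + i) * E + T ^ (h * n + i) * (1 - E) := by
        rw [← mul_add, add_sub_cancel, mul_one]
      conv_lhs => rw [h2]
      rw [Matrix.add_apply, pow_mul_eq_sum hcomm hk, Matrix.sum_apply]
      rfl
    have hshift : Tendsto (fun n : ℕ => h * n + i) atTop atTop :=
      tendsto_atTop_mono (fun n => (Nat.le_mul_of_pos_left n hh).trans (Nat.le_add_right _ _))
        tendsto_id
    have hinv : Tendsto (fun n : ℕ => (T ^ (h * n + i) * (1 - E)) a b / (n : ℝ) ^ k) atTop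
        (nhds 0) := by
      refine squeeze_zero_norm' ?_
        (tendsto_zero_iff_norm_tendsto_zero.1 ((herr a b).comp hshift))
      filter_upwards [eventually_ge_atTop 1] with n hn
      rw [norm_div]
      refine div_le_self (norm_nonneg _) ?_
      rw [norm_pow, Real.norm_natCast]
      exact one_le_pow₀ (by exact_mod_cast hn)
    have hlim : Tendsto (fun n : ℕ => (T ^ (h * n + i)) a b / (n : ℝ) ^ k) atTop
        (nhds ((k.factorial : ℝ)⁻¹ * (L * T ^ i) a b)) := by
      have hlow : Tendsto (fun n : ℕ => ∑ j ∈ Finset.range k,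
          (n.choose j : ℝ) / (n : ℝ) ^ k * (f ^ j * E * T ^ i) a b) atTop (nhds 0) := by
        rw [← Finset.sum_const_zero (s := Finset.range k)]
        refine tendsto_finsetSum _ fun j hj => ?_
        simpa using (tendsto_choose_div_pow_of_lt (Finset.mem_range.1 hj)).mul_const
          ((f ^ j * E * T ^ i) a b)
      have hall := (hlow.add ((tendsto_choose_div_pow k).mul_const ((L * T ^ i) a b))).add hinv
      rw [zero_add, add_zero] at hall
      refine hall.congr fun n => ?_
      rw [hexp, Finset.sum_range_succ, add_div, add_div, Finset.sum_div, ← hL]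
      simp only [div_mul_eq_mul_div]
    have h0 : 0 ≤ (k.factorial : ℝ)⁻¹ * (L * T ^ i) a b :=
      ge_of_tendsto' hlim fun n => div_nonneg (pow_apply_nonneg hT _ _ _) (by positivity)
    exact nonneg_of_mul_nonneg_right h0 (by positivity)
  -- `L * g` is the sum of the nonnegative matrices `L * T ^ i`, so it can vanish only if the term
  -- `i = 0`, which is `L`, does.
  have hLg : L * g ≠ 0 := by
    intro hzero
    refine hk' (Matrix.ext fun a b => le_antisymm ?_ (by simpa using hpos 0 a b))
    have h1 : (L * T ^ 0) a b ≤ ∑ i ∈ Finset.range h, (L * T ^ i) a b :=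
      Finset.single_le_sum (f := fun i => (L * T ^ i) a b) (fun i _ => hpos i a b)
        (Finset.mem_range.2 hh)
    rw [← Matrix.sum_apply, ← Finset.mul_sum, ← hg, hzero] at h1
    simpa using h1
  have hT1g : Commute (T - 1) g := hTg.sub_left (Commute.one_left g)
  have hgE : Commute g E := Commute.sum_left _ _ _ fun i _ => hcomm.pow_left i
  have hpow : ∀ n, (T - 1) ^ n * g ^ n = f ^ n := fun n => by rw [← hT1g.mul_pow, hgT]
  -- Since `(T - 1) * g = f`, powers of `g` turn powers of `T - 1` into powers of `f`; one `g` is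
  -- left over in the second claim, giving `L * g`.
  refine ⟨g ^ (k + 1) * E, ?_, ?_⟩
  · rw [← mul_assoc, hpow, hk]
  · rw [pow_succ, mul_assoc (g ^ k), hgE.eq, ← mul_assoc, ← mul_assoc, hpow]
    exact hLg

/-- Rothblum's expansion with an error bound that is uniform in the residue class. -/
theorem exists_polynomial_expansion {M : Matrix m m ℝ} (hM : ∀ i j, 0 ≤ M i j) {lam β : ℝ}
    (hlam : 0 < lam) (hβ : 0 ≤ β) (hβ1 : β < 1) {h : ℕ} (hh : 1 ≤ h)
    (heig : ∀ μ ∈ eigs (lam⁻¹ • M), μ ^ h = 1 ∨ ‖μ‖ ≤ β) :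
    ∃ S : ℕ → Matrix m m ℝ[X],
      (∀ i a b, (S i a b).natDegree ≤ jordanIndex M lam - 1) ∧
      ∀ γ, β < γ → ∃ B, 0 ≤ B ∧ ∀ n i a b,
        |((lam⁻¹ • M) ^ (h * n + i)) a b - (S i a b).eval (n : ℝ)| ≤ B * γ ^ (h * n + i) := by
  set T := lam⁻¹ • M with hTdef
  have hT : ∀ i j, 0 ≤ T i j := fun i j => mul_nonneg (inv_nonneg.2 hlam.le) (hM i j)
  obtain ⟨k, E, G, hcommE, hEE, hk, hkmin, hG⟩ := exists_fitting_idempotent (T ^ h - 1)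
  set f := T ^ h - 1 with hf
  have hTf : Commute T f := (Commute.refl T).pow_right h |>.sub_right (Commute.one_right T)
  have hcomm : Commute T E := hcommE T hTf
  have hEY : (1 - E) * (1 - E) = 1 - E := by
    rw [mul_sub, mul_one, sub_mul, one_mul, hEE]; abel
  have hcomm1 : Commute T (1 - E) := (Commute.one_right T).sub_right hcomm
  have hYpow : ∀ n, T ^ n * (1 - E) = (T * (1 - E)) ^ n * (1 - E) := by
    intro n
    induction n with
    | zero => simp
    | succ n ih =>
      calc T ^ (n + 1) * (1 - E) = (T ^ n * (1 - E)) * T := by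
            rw [pow_succ, mul_assoc, mul_assoc, hcomm1.eq]
        _ = (T * (1 - E)) ^ n * ((1 - E) * (1 - E) * T) := by rw [ih, hEY, mul_assoc]
        _ = (T * (1 - E)) ^ (n + 1) * (1 - E) := by
            rw [mul_assoc, ← hcomm1.eq, ← mul_assoc (1 - E), ← hcomm1.eq, pow_succ, ← mul_assoc]
  have hYeig : ∀ μ ∈ eigs (T * (1 - E)), ‖μ‖ ≤ β := by
    intro μ hμ
    by_cases hμ0 : μ = 0
    · rw [hμ0, norm_zero]; exact hβ
    · obtain ⟨h1, h2⟩ := eigs_mul_one_sub hcomm hEE hG hμ hμ0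
      exact (heig μ h1).resolve_left h2
  have herr : ∀ γ, β < γ → ∃ B, 0 ≤ B ∧ ∀ n a b, |(T ^ n * (1 - E)) a b| ≤ B * γ ^ n := by
    intro γ hγ
    have hγ0 : 0 < γ := hβ.trans_lt hγ
    obtain ⟨B, hB0, hB⟩ := exists_abs_pow_apply_le _ hβ hYeig hγ
    refine ⟨B * ∑ c, ∑ d, |(1 - E) c d|, by positivity, fun n a b => ?_⟩
    rw [hYpow, Matrix.mul_apply]
    calc |∑ c, ((T * (1 - E)) ^ n) a c * (1 - E) c b|
        ≤ ∑ c, |((T * (1 - E)) ^ n) a c * (1 - E) c b| := Finset.abs_sum_le_sum_abs _ _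
      _ ≤ ∑ c, B * γ ^ n * ∑ d, |(1 - E) c d| := by
          refine Finset.sum_le_sum fun c _ => ?_
          rw [abs_mul]
          exact mul_le_mul (hB n a c) (Finset.single_le_sum (f := fun d => |(1 - E) c d|)
            (fun _ _ => abs_nonneg _) (Finset.mem_univ b)) (abs_nonneg _) (by positivity)
      _ = B * (∑ c, ∑ d, |(1 - E) c d|) * γ ^ n := by rw [← Finset.mul_sum]; ring
  -- If the nilpotency index `k` of `f` on the range of `E` exceeded `ν`, the matrix `W` would have
  -- a nonzero image under a power of `T - 1` with exponent at least `ν`.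
  have hkν : k ≤ jordanIndex M lam := by
    rcases k with _ | k
    · exact Nat.zero_le _
    have hk' : f ^ k * E ≠ 0 := fun h0 => by have := hkmin k h0; omega
    obtain ⟨W, hW1, hW2⟩ := exists_sub_one_pow_mul_ne_zero hT hh hcomm hk hk' (by
      intro a b
      obtain ⟨γ, hγ1, hγ2⟩ := exists_between hβ1
      obtain ⟨B, -, hB⟩ := herr γ hγ1
      refine squeeze_zero_norm (a := fun n => B * γ ^ n) (fun n => hB n a b) ?_
      simpa using (tendsto_pow_atTop_nhds_zero_of_lt_one (hβ.trans hγ1.le) hγ2).const_mul B)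
    have hW3 := sub_one_pow_jordanIndex_mul_eq_zero hlam.ne' hW1
    by_contra! hlt
    refine hW2 ?_
    rw [← Nat.sub_add_cancel (Nat.lt_succ_iff.1 hlt), pow_add, mul_assoc, hW3, mul_zero]
  refine ⟨fun i => Matrix.of fun a b => ∑ j ∈ Finset.range k,
    Polynomial.C ((f ^ j * E * T ^ i) a b) * choosePoly j, fun i a b => ?_, fun γ hγ => ?_⟩
  · simp only [Matrix.of_apply]
    refine Polynomial.natDegree_sum_le_of_forall_le _ _ fun j hj => ?_
    refine (Polynomial.natDegree_C_mul_le _ _).trans ?_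
    rw [choosePoly_natDegree]
    have := Finset.mem_range.1 hj
    omega
  · obtain ⟨B, hB0, hB⟩ := herr γ hγ
    refine ⟨B, hB0, fun n i a b => ?_⟩
    convert hB (h * n + i) a b using 2
    rw [mul_sub, mul_one, Matrix.sub_apply, pow_mul_eq_sum hcomm hk, Matrix.sum_apply]
    simp only [Matrix.of_apply, Polynomial.eval_finsetSum]
    congr 1
    refine Finset.sum_congr rfl fun j _ => ?_
    rw [Polynomial.eval_mul, Polynomial.eval_C, choosePoly_eval, Matrix.smul_apply, smul_eq_mul,
      mul_comm]

end Expansion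

/-! ### From the expansion to the asymptotics of column sums -/

section Asymptotics

variable {m : Type*} [Fintype m] [DecidableEq m]

theorem secModulus_nonneg (M : Matrix m m ℝ) (lam : ℝ) : 0 ≤ secModulus M lam :=
  Real.sSup_nonneg fun _ ⟨μ, _, _, hx⟩ => hx ▸ norm_nonneg μ

theorem norm_le_secModulus {M : Matrix m m ℝ} {lam : ℝ} {μ : ℂ} (hμ : μ ∈ eigs M)
    (h : ‖μ‖ < lam) : ‖μ‖ ≤ secModulus M lam :=
  le_csSup ⟨lam, fun _ ⟨_, _, hν, hx⟩ => hx ▸ hν.le⟩ ⟨μ, hμ, h, rfl⟩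

theorem secModulus_lt (M : Matrix m m ℝ) {lam : ℝ} (hlam : 0 < lam) : secModulus M lam < lam := by
  classical
  rw [secModulus]
  set s := {x : ℝ | ∃ μ ∈ eigs M, ‖μ‖ < lam ∧ x = ‖μ‖} with hs
  rcases s.eq_empty_or_nonempty with h | h
  -- The real supremum of the empty set is `0` by default, matching the convention for a missing
  -- second eigenvalue.
  · rw [h, Real.sSup_empty]; exact hlam
  · have hfin : s.Finite := by
      refine ((eigs M).toFinset.finite_toSet.image fun μ => ‖μ‖).subset ?_
      rintro x ⟨μ, hμ, -, rfl⟩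
      exact ⟨μ, by simpa using hμ, rfl⟩
    obtain ⟨μ, -, hμ, hx⟩ := h.csSup_mem hfin
    rw [hx]; exact hμ

theorem mul_mem_eigs_of_mem_eigs_smul {M : Matrix m m ℝ} {lam : ℝ} (hlam : lam ≠ 0) {μ : ℂ}
    (hμ : μ ∈ eigs (lam⁻¹ • M)) : lam * μ ∈ eigs M := by
  obtain ⟨v, hv0, hv⟩ := (mem_eigs_iff _ _).1 hμ
  refine (mem_eigs_iff _ _).2 ⟨v, hv0, ?_⟩
  have hmap : M.map Complex.ofReal = (lam : ℂ) • (lam⁻¹ • M).map Complex.ofReal := by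
    ext i j
    simp [mul_inv_cancel_left₀ (Complex.ofReal_ne_zero.2 hlam)]
  rw [hmap, Matrix.smul_mulVec, hv, smul_smul]

theorem IsPeriods.lcm_pos {M : Matrix m m ℝ} {lam : ℝ} {hs : Multiset ℕ}
    (hper : IsPeriods M lam hs) : 1 ≤ hs.lcm := by
  rw [Nat.one_le_iff_ne_zero, Ne, Multiset.lcm_eq_zero_iff]
  intro h
  exact absurd (hper.2.1 0 h) (by norm_num)

theorem IsPeriods.pow_lcm_eq_one_or_norm_le {M : Matrix m m ℝ} {lam : ℝ} {hs : Multiset ℕ}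
    (hper : IsPeriods M lam hs) (hPF : IsPFEigenvalue M lam) (hlam : 0 < lam) {μ : ℂ}
    (hμ : μ ∈ eigs (lam⁻¹ • M)) : μ ^ hs.lcm = 1 ∨ ‖μ‖ ≤ secModulus M lam / lam := by
  have hlamC : (lam : ℂ) ≠ 0 := Complex.ofReal_ne_zero.2 hlam.ne'
  have hmem := mul_mem_eigs_of_mem_eigs_smul hlam.ne' hμ
  have hnorm : ‖(lam : ℂ) * μ‖ = lam * ‖μ‖ := by rw [norm_mul, Complex.norm_of_nonneg hlam.le]
  rcases (hPF.2.2 _ hmem).eq_or_lt with h | h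
  · left
    obtain ⟨-, h1, h2⟩ := hper
    rw [range_bind_pure_cast] at h2
    have h3 := Multiset.mem_filter (p := fun μ : ℂ => ‖μ‖ = lam).2 ⟨hmem, h⟩
    rw [h2, Multiset.mem_bind] at h3
    obtain ⟨l, hl, h4⟩ := h3
    obtain ⟨k, -, h5⟩ := Multiset.mem_map.1 h4
    have hμeq : μ = Complex.exp (2 * Real.pi * Complex.I / l) ^ k := by
      rw [← Complex.exp_nat_mul]
      exact (mul_left_cancel₀ hlamC (by rw [← h5, mul_comm])).symm
    have hprim := Complex.isPrimitiveRoot_exp l (Nat.one_le_iff_ne_zero.1 (h1 l hl))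
    obtain ⟨d, hd⟩ := Multiset.dvd_lcm hl
    rw [hd, hμeq, pow_mul, pow_right_comm _ k, hprim.pow_eq_one, one_pow, one_pow]
  · right
    rw [le_div_iff₀ hlam, mul_comm, ← hnorm]
    exact norm_le_secModulus hmem h

/-- The second conclusion measures the error in the full exponent `h n + i`, with one constant for
all residue classes; this yields the ratio `|λ^{sec}/λ|` for `b_n`, not just its `h`-th power along
each class. -/
theorem exists_isRothblumExpansion {M : Matrix m m ℝ} (hM : ∀ i j, 0 ≤ M i j) {lam : ℝ}
    {hs : Multiset ℕ} (hPF : IsPFEigenvalue M lam) (hper : IsPeriods M lam hs) (hlam : 0 < lam) :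
    ∃ S : Fin hs.lcm → Matrix m m ℝ[X], IsRothblumExpansion M lam hs.lcm S ∧
      ∀ γ, secModulus M lam / lam < γ → ∃ B, 0 ≤ B ∧ ∀ (n : ℕ) (i : Fin hs.lcm) (a b : m),
        |((lam⁻¹ • M) ^ (hs.lcm * n + (i : ℕ))) a b - (S i a b).eval (n : ℝ)| ≤
          B * γ ^ (hs.lcm * n + (i : ℕ)) := by
  set β := secModulus M lam / lam with hβdef
  have hβ : 0 ≤ β := div_nonneg (secModulus_nonneg M lam) hlam.le
  have hβ1 : β < 1 := (div_lt_one hlam).2 (secModulus_lt M hlam)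
  have hh := hper.lcm_pos
  obtain ⟨S, hdeg, hS⟩ := exists_polynomial_expansion hM hlam hβ hβ1 hh
    fun μ hμ => hper.pow_lcm_eq_one_or_norm_le hPF hlam hμ
  have hgeom : ∀ i a b, ConvergesGeometrically (fun n : ℕ =>
      ((lam⁻¹ • M) ^ (hs.lcm * n + i)) a b - (S i a b).eval (n : ℝ)) 0 (β ^ hs.lcm) := by
    refine fun i a b => ⟨pow_nonneg hβ _, pow_lt_one₀ hβ hβ1 (Nat.one_le_iff_ne_zero.1 hh),
      fun δ hδ1 hδ2 => ?_⟩
    have hδ0 : 0 < δ := (pow_nonneg hβ _).trans_lt hδ1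
    set γ := δ ^ ((hs.lcm : ℝ)⁻¹) with hγdef
    have hγ0 : 0 < γ := Real.rpow_pos_of_pos hδ0 _
    have hγh : γ ^ hs.lcm = δ :=
      Real.rpow_inv_natCast_pow hδ0.le (Nat.one_le_iff_ne_zero.1 hh)
    have hγβ : β < γ := lt_of_pow_lt_pow_left₀ hs.lcm hγ0.le (by rwa [hγh])
    obtain ⟨B, hB0, hB⟩ := hS γ hγβ
    refine ⟨B * γ ^ i, fun n => ?_⟩
    rw [sub_zero, div_le_iff₀ (by positivity), Real.norm_eq_abs]
    refine (hB n i a b).trans_eq ?_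
    rw [pow_add, pow_mul, hγh]; ring
  refine ⟨fun i => S i, fun i a b => ⟨hdeg i a b, ?_, hgeom i a b⟩, fun γ hγ => ?_⟩
  · obtain ⟨-, h1, h2⟩ := hgeom i a b
    obtain ⟨δ, hδ1, hδ2⟩ := exists_between h1
    have hδ0 : 0 < δ := (pow_nonneg hβ _).trans_lt hδ1
    obtain ⟨B, hB⟩ := h2 δ hδ1 hδ2
    refine squeeze_zero_norm (a := fun n => B * δ ^ n) (fun n => ?_) ?_
    · have := hB n
      rwa [sub_zero, div_le_iff₀ (by positivity)] at this
    · simpa using (tendsto_pow_atTop_nhds_zero_of_lt_one hδ0.le hδ2).const_mul B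
  · obtain ⟨B, hB0, hB⟩ := hS γ hγ
    exact ⟨B, hB0, fun n i a b => hB n i a b⟩

theorem Polynomial.eq_zero_of_tendsto_natCast {p : ℝ[X]}
    (h : Tendsto (fun n : ℕ => p.eval (n : ℝ)) atTop (nhds 0)) : p = 0 := by
  by_cases hdeg : 0 < p.degree
  · have h1 := (p.abs_tendsto_atTop hdeg).comp (tendsto_natCast_atTop_atTop (R := ℝ))
    exact absurd h.abs (not_tendsto_nhds_of_tendsto_atTop h1 _)
  · rw [Polynomial.eq_C_of_degree_le_zero (not_lt.1 hdeg)] at h ⊢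
    simp only [Polynomial.eval_C] at h
    rw [tendsto_nhds_unique tendsto_const_nhds h, Polynomial.C_0]

/-- Two expansions approximate the same sequence, so their difference is a polynomial tending to `0`
along the integers. -/
theorem IsRothblumExpansion.unique {M : Matrix m m ℝ} {lam : ℝ} {h : ℕ}
    {S S' : Fin h → Matrix m m ℝ[X]} (hS : IsRothblumExpansion M lam h S)
    (hS' : IsRothblumExpansion M lam h S') : S' = S := by
  funext i
  ext1 a b
  rw [← sub_eq_zero]
  refine Polynomial.eq_zero_of_tendsto_natCast ?_
  have := (hS i a b).2.1.sub (hS' i a b).2.1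
  rw [sub_zero] at this
  refine this.congr fun n => ?_
  rw [Polynomial.eval_sub]; ring

/-- Orthogonality of the characters of `ℤ / h` picks out the residue class of `n`. -/
theorem asymptoticFormula_eq {l : Type*} [Fintype l] {lam : ℝ} {h : ℕ} (hh : 0 < h)
    (S : Fin h → Matrix l l ℝ[X]) (u : l) (n : ℕ) : asymptoticFormula lam h S u n =
      ((columnSum (S ⟨n % h, Nat.mod_lt n hh⟩) u ((n / h : ℕ) : ℝ) * lam ^ n : ℝ) : ℂ) := by
  have hprim := Complex.isPrimitiveRoot_exp h hh.ne'
  set ζ := Complex.exp (2 * Real.pi * Complex.I / h) with hζ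
  have hh0 : (h : ℂ) ≠ 0 := Nat.cast_ne_zero.2 hh.ne'
  have hsum : ∀ j : Fin h, ∑ i : Fin h, ζ ^ (((i : ℕ) : ℤ) * ((n : ℤ) - ((j : ℕ) : ℤ))) =
      if j = ⟨n % h, Nat.mod_lt n hh⟩ then (h : ℂ) else 0 := by
    intro j
    set w := ζ ^ ((n : ℤ) - ((j : ℕ) : ℤ)) with hw
    have h1 : ∑ i : Fin h, ζ ^ (((i : ℕ) : ℤ) * ((n : ℤ) - ((j : ℕ) : ℤ))) =
        ∑ i ∈ Finset.range h, w ^ i := by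
      rw [← Fin.sum_univ_eq_sum_range (fun i => w ^ i)]
      refine Finset.sum_congr rfl fun i _ => ?_
      rw [hw, mul_comm, _root_.zpow_mul, zpow_natCast]
    have hiff : w = 1 ↔ j = ⟨n % h, Nat.mod_lt n hh⟩ := by
      rw [hw, hprim.zpow_eq_one_iff_dvd, ← Int.modEq_iff_dvd, Int.natCast_modEq_iff, Fin.ext_iff,
        Nat.ModEq, Nat.mod_eq_of_lt j.2]
    rw [h1]
    split_ifs with hj
    · rw [hiff.2 hj]; simp
    · have hwh : w ^ h = 1 := by
        rw [hw, ← zpow_natCast, ← _root_.zpow_mul, mul_comm, _root_.zpow_mul, zpow_natCast,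
          hprim.pow_eq_one, _root_.one_zpow]
      have := mul_geom_sum w h
      rw [hwh, sub_self] at this
      exact (mul_eq_zero.1 this).resolve_left (sub_ne_zero.2 fun hw1 => hj (hiff.1 hw1))
  rw [asymptoticFormula, Finset.sum_comm]
  simp_rw [← Finset.mul_sum, ← hζ, hsum]
  rw [Complex.ofReal_mul, Complex.ofReal_pow]
  congr 1
  simp only [mul_ite, mul_zero, Finset.sum_ite_eq', Finset.mem_univ, if_true]
  field_simp

/-- In the row where an eigenvector for `lam` has its largest modulus, the eigenvalue equation
already forces the row sum of `M ^ n` to be at least `lam ^ n`. -/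
theorem pow_le_sum_pow_apply {M : Matrix m m ℝ} (hM : ∀ i j, 0 ≤ M i j) {lam : ℝ}
    (hPF : IsPFEigenvalue M lam) (n : ℕ) : lam ^ n ≤ ∑ i, ∑ j, (M ^ n) i j := by
  obtain ⟨hlam, hmem, -⟩ := hPF
  obtain ⟨v, hv0, hv⟩ := (mem_eigs_iff _ _).1 hmem
  have hpow : (M ^ n).map Complex.ofReal *ᵥ v = (lam : ℂ) ^ n • v := by
    induction n with
    | zero => rw [pow_zero, map_ofReal_one, Matrix.one_mulVec, pow_zero, one_smul]
    | succ n ih =>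
      rw [pow_succ, map_ofReal_mul, ← Matrix.mulVec_mulVec, hv, Matrix.mulVec_smul, ih, smul_smul,
        pow_succ, mul_comm]
  obtain ⟨i₁, hi₁⟩ := Function.ne_iff.1 hv0
  have : Nonempty m := ⟨i₁⟩
  obtain ⟨i, hi⟩ := Finite.exists_max fun i => ‖v i‖
  have hvi : 0 < ‖v i‖ := (norm_pos_iff.2 hi₁).trans_le (hi i₁)
  have hnn := Matrix.pow_apply_nonneg hM n
  have h1 : lam ^ n * ‖v i‖ ≤ (∑ j, (M ^ n) i j) * ‖v i‖ := by
    calc lam ^ n * ‖v i‖ = ‖∑ j, ((M ^ n) i j : ℂ) * v j‖ := by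
          have h2 : ∑ j, ((M ^ n) i j : ℂ) * v j = (lam : ℂ) ^ n * v i := by
            simpa [Matrix.mulVec, dotProduct] using congrFun hpow i
          rw [h2, norm_mul, norm_pow, Complex.norm_of_nonneg hlam]
      _ ≤ ∑ j, ‖((M ^ n) i j : ℂ) * v j‖ := norm_sum_le _ _
      _ ≤ ∑ j, (M ^ n) i j * ‖v i‖ := by
          refine Finset.sum_le_sum fun j _ => ?_
          rw [norm_mul, Complex.norm_of_nonneg (hnn i j)]
          exact mul_le_mul_of_nonneg_left (hi j) (hnn i j)
      _ = _ := by rw [Finset.sum_mul]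
  refine (le_of_mul_le_mul_right h1 hvi).trans ?_
  exact Finset.single_le_sum (f := fun i => ∑ j, (M ^ n) i j)
    (fun i _ => Finset.sum_nonneg fun j _ => hnn i j) (Finset.mem_univ i)

theorem pow_card_eq_zero_of_eigs {M : Matrix m m ℝ} (h : ∀ μ ∈ eigs M, μ = 0) :
    M ^ Fintype.card m = 0 := by
  have hchar : (M.map Complex.ofReal).charpoly = Polynomial.X ^ Fintype.card m := by
    have h1 := (IsAlgClosed.splits (M.map Complex.ofReal).charpoly).eq_prod_roots_of_monic
      (Matrix.charpoly_monic _)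
    have h2 : (M.map Complex.ofReal).charpoly.roots =
        Multiset.replicate (Multiset.card (M.map Complex.ofReal).charpoly.roots) 0 :=
      Multiset.eq_replicate_card.2 h
    rw [← (IsAlgClosed.splits _).natDegree_eq_card_roots, Matrix.charpoly_natDegree_eq_dim] at h2
    rw [h1, h2]
    simp
  have h3 := Matrix.aeval_self_charpoly (M.map Complex.ofReal)
  rw [hchar, map_pow, Polynomial.aeval_X, ← map_ofReal_pow] at h3
  ext i j
  simpa using congrFun (congrFun h3 i) j

theorem tendsto_const_mul_pow_rpow {c x : ℝ} (hc : 0 < c) (hx : 0 ≤ x) :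
    Tendsto (fun n : ℕ => (c * x ^ n) ^ (1 / (n : ℝ))) atTop (nhds x) := by
  have h1 : Tendsto (fun n : ℕ => c ^ (1 / (n : ℝ))) atTop (nhds 1) := by
    have := (tendsto_const_nhds (x := c)).rpow (tendsto_one_div_atTop_nhds_zero_nat (𝕜 := ℝ))
      (Or.inl hc.ne')
    simpa using this
  have h2 := h1.mul_const x
  rw [one_mul] at h2
  refine h2.congr' ?_
  filter_upwards [eventually_ge_atTop 1] with n hn
  rw [Real.mul_rpow hc.le (by positivity), one_div,
    Real.pow_rpow_inv_natCast hx (Nat.one_le_iff_ne_zero.1 hn)]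

/-- The column sum is squeezed between `C⁻¹ * lam ^ n` and a constant times `γ ^ n` for arbitrary `γ
> lam`; constants disappear under the `n`-th root. -/
theorem tendsto_columnSum_rpow {M : Matrix m m ℝ} (hM : ∀ i j, 0 ≤ M i j) {lam : ℝ}
    (hPF : IsPFEigenvalue M lam) (u : m) {C : ℝ} (hC : 0 < C)
    (hCb : ∀ n : ℕ, ∑ i, ∑ j, (M ^ n) i j ≤ C * ∑ k, (M ^ n) k u) :
    Tendsto (fun n : ℕ => (∑ k, (M ^ n) k u) ^ (1 / (n : ℝ))) atTop (nhds lam) := by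
  have hlam := hPF.1
  have hlow : ∀ n : ℕ, C⁻¹ * lam ^ n ≤ ∑ k, (M ^ n) k u := fun n => by
    rw [inv_mul_le_iff₀ hC]
    exact (pow_le_sum_pow_apply hM hPF n).trans (hCb n)
  refine tendsto_order.2 ⟨fun a ha => ?_, fun a ha => ?_⟩
  · filter_upwards [(tendsto_const_mul_pow_rpow (inv_pos.2 hC) hlam).eventually_const_lt ha]
      with n hn
    exact hn.trans_le (Real.rpow_le_rpow (by positivity) (hlow n) (by positivity))
  · obtain ⟨γ, hγ1, hγ2⟩ := exists_between ha
    obtain ⟨B, hB0, hB⟩ := exists_abs_pow_apply_le M hlam hPF.2.2 hγ1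
    have : Nonempty m := ⟨u⟩
    have hcard : (0 : ℝ) < Fintype.card m := by exact_mod_cast Fintype.card_pos
    have hγ0 : 0 ≤ γ := hlam.trans hγ1.le
    have hup : ∀ n : ℕ, ∑ k, (M ^ n) k u ≤ (Fintype.card m * B) * γ ^ n := fun n => by
      refine (Finset.sum_le_sum fun k _ => (le_abs_self _).trans (hB n k u)).trans_eq ?_
      simp [mul_assoc]
    filter_upwards [(tendsto_const_mul_pow_rpow (mul_pos hcard hB0) hγ0).eventually_lt_const hγ2]
      with n hn
    exact (Real.rpow_le_rpow (Finset.sum_nonneg fun k _ => Matrix.pow_apply_nonneg hM n k u)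
      (hup n) (by positivity)).trans_lt hn

/-- The column sums of the powers of a nonnegative matrix follow Rothblum's expansion as soon as
they control all entries. -/
theorem exists_columnSum_asymptotics {M : Matrix m m ℝ} (hM : ∀ i j, 0 ≤ M i j) {lam : ℝ}
    {hs : Multiset ℕ} (hPF : IsPFEigenvalue M lam) (hper : IsPeriods M lam hs) (hlam : 0 < lam)
    (u : m) {C : ℝ} (hC : 0 < C)
    (hCb : ∀ n : ℕ, ∑ i, ∑ j, (M ^ n) i j ≤ C * ∑ k, (M ^ n) k u) :
    ∃ S : Fin hs.lcm → Matrix m m ℝ[X], IsRothblumExpansion M lam hs.lcm S ∧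
      Asymptotics.IsEquivalent atTop (fun n : ℕ => ((∑ k, (M ^ n) k u : ℝ) : ℂ))
        (asymptoticFormula lam hs.lcm S u) ∧
      ConvergesGeometrically (fun n : ℕ => ((∑ k, (M ^ n) k u : ℝ) : ℂ) /
        asymptoticFormula lam hs.lcm S u n) 1 (secModulus M lam / lam) := by
  have hh := hper.lcm_pos
  obtain ⟨S, hS, herr⟩ := exists_isRothblumExpansion hM hPF hper hlam
  generalize hs.lcm = h at hh S hS herr ⊢
  set β := secModulus M lam / lam with hβdef
  have hβ : 0 ≤ β := div_nonneg (secModulus_nonneg M lam) hlam.le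
  have hβ1 : β < 1 := (div_lt_one hlam).2 (secModulus_lt M hlam)
  set b : ℕ → ℝ := fun n => ∑ k, (M ^ n) k u with hb
  set s : ℕ → ℝ := fun n => columnSum (S ⟨n % h, Nat.mod_lt n hh⟩) u ((n / h : ℕ) : ℝ) with hs_def
  have hform : ∀ n, asymptoticFormula lam h S u n = ((s n * lam ^ n : ℝ) : ℂ) :=
    asymptoticFormula_eq hh S u
  have hlow : ∀ n, C⁻¹ ≤ b n / lam ^ n := fun n => by
    rw [le_div_iff₀ (by positivity), inv_mul_le_iff₀ hC]
    exact (pow_le_sum_pow_apply hM hPF n).trans (hCb n)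
  have hdiff : ∀ γ, β < γ → ∃ B, 0 ≤ B ∧ ∀ n, |b n / lam ^ n - s n| ≤ B * γ ^ n := by
    intro γ hγ
    obtain ⟨B, hB0, hB⟩ := herr γ hγ
    refine ⟨Fintype.card m * B, by positivity, fun n => ?_⟩
    have h1 : b n / lam ^ n - s n = ∑ k, (((lam⁻¹ • M) ^ n) k u -
        (S ⟨n % h, Nat.mod_lt n hh⟩ k u).eval ((n / h : ℕ) : ℝ)) := by
      simp only [Finset.sum_sub_distrib, hs_def, columnSum, hb, Finset.sum_div]
      congr 1
      refine Finset.sum_congr rfl fun k _ => ?_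
      rw [smul_pow, Matrix.smul_apply, smul_eq_mul, inv_pow, div_eq_inv_mul]
    rw [h1]
    refine (Finset.abs_sum_le_sum_abs _ _).trans ?_
    refine (Finset.sum_le_sum (g := fun _ => B * γ ^ n) fun k _ => ?_).trans_eq
      (by simp [mul_assoc])
    have h2 := hB (n / h) ⟨n % h, Nat.mod_lt n hh⟩ k u
    simpa only [Nat.div_add_mod] using h2
  -- The normalized column sums stay above `C⁻¹` and differ from `s n` by a null sequence. Hence `1
  -- / s n ≤ 2 * C` eventually, the source of the constant `2 * C * B` below.
  have hs_low : ∀ᶠ n in atTop, C⁻¹ / 2 ≤ s n := by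
    obtain ⟨γ, hγ1, hγ2⟩ := exists_between hβ1
    obtain ⟨B, hB0, hB⟩ := hdiff γ hγ1
    have ht : Tendsto (fun n : ℕ => B * γ ^ n) atTop (nhds 0) := by
      simpa using (tendsto_pow_atTop_nhds_zero_of_lt_one (hβ.trans hγ1.le) hγ2).const_mul B
    filter_upwards [ht.eventually_lt_const (half_pos (inv_pos.2 hC))] with n hn
    have h1 := (abs_le.1 (hB n)).2
    have h2 := hlow n
    linarith
  have hratio : ∀ γ, β < γ → ∃ B, ∀ᶠ n in atTop,
      ‖(b n : ℂ) / asymptoticFormula lam h S u n - 1‖ ≤ B * γ ^ n := by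
    intro γ hγ
    obtain ⟨B, hB0, hB⟩ := hdiff γ hγ
    refine ⟨2 * C * B, ?_⟩
    filter_upwards [hs_low] with n hn
    have hs0 : 0 < s n := (half_pos (inv_pos.2 hC)).trans_le hn
    have hl0 : 0 < lam ^ n := by positivity
    have h1 : (b n : ℂ) / asymptoticFormula lam h S u n - 1 =
        (((b n / lam ^ n - s n) / s n : ℝ) : ℂ) := by
      rw [hform, ← Complex.ofReal_div, ← Complex.ofReal_one, ← Complex.ofReal_sub]
      congr 1
      field_simp
    rw [h1, Complex.norm_real, Real.norm_eq_abs, abs_div, abs_of_pos hs0, div_le_iff₀ hs0]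
    refine (hB n).trans ?_
    have hγ0 : 0 ≤ γ ^ n := pow_nonneg (hβ.trans hγ.le) n
    have h2 : 1 ≤ 2 * C * s n := by
      calc (1 : ℝ) = 2 * C * (C⁻¹ / 2) := by field_simp
        _ ≤ 2 * C * s n := by gcongr
    nlinarith [mul_nonneg hB0 hγ0]
  refine ⟨S, hS, ?_, hβ, hβ1, fun γ hγ1 hγ2 => ?_⟩
  · rw [Asymptotics.isEquivalent_iff_tendsto_one]
    · obtain ⟨γ, hγ1, hγ2⟩ := exists_between hβ1
      obtain ⟨B, hB⟩ := hratio γ hγ1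
      rw [tendsto_iff_norm_sub_tendsto_zero]
      refine squeeze_zero' (Eventually.of_forall fun n => norm_nonneg _) hB ?_
      simpa using (tendsto_pow_atTop_nhds_zero_of_lt_one (hβ.trans hγ1.le) hγ2).const_mul B
    · filter_upwards [hs_low] with n hn
      have hs0 : 0 < s n := (half_pos (inv_pos.2 hC)).trans_le hn
      rw [hform]
      exact Complex.ofReal_ne_zero.2 (by positivity)
  · obtain ⟨B, hB⟩ := hratio γ hγ1
    have hγ0 : 0 < γ := hβ.trans_lt hγ1
    have hbdd : BddAbove (Set.range fun n : ℕ =>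
        ‖(b n : ℂ) / asymptoticFormula lam h S u n - 1‖ / γ ^ n) := by
      -- The finitely many early `n`, where `s n` may even vanish, affect only the bound.
      refine (isBoundedUnder_of_eventually_le (a := B) ?_).bddAbove_range
      filter_upwards [hB] with n hn
      rwa [div_le_iff₀ (by positivity)]
    obtain ⟨B', hB'⟩ := hbdd
    exact ⟨B', fun n => hB' ⟨n, rfl⟩⟩

end Asymptotics

/-! ### Translating the algebra into its action matrix -/

namespace FiniteBasedAlgebra

variable {K : Subring ℂ} {R ι : Type*} [Ring R] [Algebra K R]

theorem ofReal_structConst (A : FiniteBasedAlgebra K R ι) (i j k : ι) :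
    (A.structConst i j k : ℂ) = ((A.basis.repr (A.basis i * A.basis j) k : K) : ℂ) := by
  obtain ⟨x, -, hx⟩ := A.nonneg i j k
  rw [structConst, hx, Complex.ofReal_re]

theorem structConst_nonneg (A : FiniteBasedAlgebra K R ι) (i j k : ι) :
    0 ≤ A.structConst i j k := by
  obtain ⟨x, hx0, hx⟩ := A.nonneg i j k
  rwa [structConst, hx, Complex.ofReal_re]

theorem repr_basis_mul_basis (A : FiniteBasedAlgebra K R ι) (i j k : ι) :
    (Algebra.TensorProduct.basis ℂ A.basis).repr
      (Algebra.TensorProduct.basis ℂ A.basis i * Algebra.TensorProduct.basis ℂ A.basis j) k =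
      A.structConst i j k := by
  rw [Algebra.TensorProduct.basis_apply, Algebra.TensorProduct.basis_apply,
    Algebra.TensorProduct.tmul_mul_tmul, one_mul, Algebra.TensorProduct.basis_repr_tmul,
    ofReal_structConst]
  simp
  rfl

variable [Fintype ι]

theorem preActionMatrix_nonneg (A : FiniteBasedAlgebra K R ι) (a : ι → ℝ≥0) (k j : ι) :
    0 ≤ A.preActionMatrix a k j :=
  Finset.sum_nonneg fun i _ => mul_nonneg (a i).2 (A.structConst_nonneg i j k)

theorem elem_eq_sum_smul (A : FiniteBasedAlgebra K R ι) (a : ι → ℝ≥0) :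
    A.elem a = ∑ i, ((a i : ℝ) : ℂ) • Algebra.TensorProduct.basis ℂ A.basis i := by
  rw [elem]
  refine Finset.sum_congr rfl fun i _ => ?_
  rw [Algebra.TensorProduct.basis_apply, TensorProduct.smul_tmul', smul_eq_mul, mul_one]

theorem mem_component_iff (A : FiniteBasedAlgebra K R ι) (a : ι → ℝ≥0) {x y : ι}
    (h : A.preActionMatrix a x y ≠ 0) : x ∈ A.component a ↔ y ∈ A.component a :=
  ⟨fun hx => Relation.EqvGen.trans _ _ _ hx (.rel _ _ h),
    fun hy => Relation.EqvGen.trans _ _ _ hy (.symm _ _ (.rel _ _ h))⟩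

theorem sum_component_eq_sum (A : FiniteBasedAlgebra K R ι) (a : ι → ℝ≥0) {f : ι → ℝ}
    (hf : ∀ i, i ∉ A.component a → f i = 0) : ∑ i : A.component a, f i = ∑ i, f i := by
  classical
  rw [← Finset.sum_subtype (Finset.univ.filter (· ∈ A.component a)) (by simp) f]
  exact Finset.sum_filter_of_ne fun i _ hi => by
    by_contra h
    exact hi (hf i h)

theorem sum_component_le_sum (A : FiniteBasedAlgebra K R ι) (a : ι → ℝ≥0) {f : ι → ℝ}
    (hf : ∀ i, 0 ≤ f i) : ∑ i : A.component a, f i ≤ ∑ i, f i := by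
  classical
  rw [← Finset.sum_subtype (Finset.univ.filter (· ∈ A.component a)) (by simp) f]
  exact Finset.sum_le_sum_of_subset_of_nonneg (Finset.filter_subset _ _) fun i _ _ => hf i

theorem actionMatrix_nonneg (A : FiniteBasedAlgebra K R ι) (a : ι → ℝ≥0) (k j : A.component a) :
    0 ≤ A.actionMatrix a k j :=
  A.preActionMatrix_nonneg a k j

variable [DecidableEq ι]

/-- The pre-action matrix describes left multiplication by `c`. -/
theorem leftMulMatrix_elem_pow (A : FiniteBasedAlgebra K R ι) (a : ι → ℝ≥0) (n : ℕ) :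
    Algebra.leftMulMatrix (Algebra.TensorProduct.basis ℂ A.basis) (A.elem a ^ n) =
      (A.preActionMatrix a ^ n).map Complex.ofReal := by
  have h1 : Algebra.leftMulMatrix (Algebra.TensorProduct.basis ℂ A.basis) (A.elem a) =
      (A.preActionMatrix a).map Complex.ofReal := by
    ext k j
    rw [Algebra.leftMulMatrix_eq_repr_mul, elem_eq_sum_smul, Finset.sum_mul, map_sum,
      Finsupp.finsetSum_apply]
    simp only [smul_mul_assoc, map_smul, Finsupp.smul_apply, repr_basis_mul_basis,
      preActionMatrix, Matrix.map_apply, Matrix.of_apply, smul_eq_mul, Complex.ofReal_sum,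
      Complex.ofReal_mul]
  rw [map_pow, h1]
  exact (map_pow (Complex.ofRealHom.mapMatrix (m := ι)) (A.preActionMatrix a) n).symm

theorem repr_elem_pow (A : FiniteBasedAlgebra K R ι) (a : ι → ℝ≥0) (n : ℕ) (k : ι) :
    (Algebra.TensorProduct.basis ℂ A.basis).repr (A.elem a ^ n) k =
      ((A.preActionMatrix a ^ n) k A.e : ℝ) := by
  have h := congrFun (congrFun (A.leftMulMatrix_elem_pow a n) k) A.e
  rwa [Algebra.leftMulMatrix_eq_repr_mul, Algebra.TensorProduct.basis_apply, A.basis_e,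
    ← Algebra.TensorProduct.one_def, mul_one] at h

theorem powCoeff_eq (A : FiniteBasedAlgebra K R ι) (a : ι → ℝ≥0) (n : ℕ) (k : ι) :
    A.powCoeff a n k = (A.preActionMatrix a ^ n) k A.e := by
  rw [powCoeff, repr_elem_pow, Complex.ofReal_re]

/-- Since `c ^ n * c_j` is determined by `c ^ n`, the column of the unit determines all columns. -/
theorem preActionMatrix_pow_apply (A : FiniteBasedAlgebra K R ι) (a : ι → ℝ≥0) (n : ℕ) (k j : ι) :
    (A.preActionMatrix a ^ n) k j =
      ∑ i, (A.preActionMatrix a ^ n) i A.e * A.structConst i j k := by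
  have h := congrFun (congrFun (A.leftMulMatrix_elem_pow a n) k) j
  rw [Algebra.leftMulMatrix_eq_repr_mul,
    ← (Algebra.TensorProduct.basis ℂ A.basis).sum_repr (A.elem a ^ n), Finset.sum_mul, map_sum,
    Finsupp.finsetSum_apply] at h
  simp only [smul_mul_assoc, map_smul, Finsupp.smul_apply, repr_basis_mul_basis, repr_elem_pow,
    smul_eq_mul, Matrix.map_apply] at h
  exact_mod_cast h.symm

theorem preActionMatrix_pow_eq_zero (A : FiniteBasedAlgebra K R ι) (a : ι → ℝ≥0) (n : ℕ) {k j : ι}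
    (hj : j ∈ A.component a) (hk : k ∉ A.component a) : (A.preActionMatrix a ^ n) k j = 0 := by
  induction n generalizing k with
  | zero => rw [pow_zero, Matrix.one_apply_ne fun h => hk (by rwa [h])]
  | succ n ih =>
    rw [pow_succ', Matrix.mul_apply]
    refine Finset.sum_eq_zero fun i _ => ?_
    by_cases h : A.preActionMatrix a k i = 0
    · rw [h, zero_mul]
    · rw [ih fun hi => hk ((A.mem_component_iff a h).2 hi), mul_zero]

/-- No edge joins the component of the unit to its complement, so restricting to it commutes with
taking powers. -/
theorem actionMatrix_pow_apply (A : FiniteBasedAlgebra K R ι) (a : ι → ℝ≥0) (n : ℕ)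
    (k j : A.component a) : (A.actionMatrix a ^ n) k j = (A.preActionMatrix a ^ n) k j := by
  induction n generalizing k with
  | zero => simp [Matrix.one_apply, Subtype.ext_iff]
  | succ n ih =>
    rw [pow_succ', pow_succ', Matrix.mul_apply, Matrix.mul_apply]
    simp only [ih]
    refine A.sum_component_eq_sum a (f := fun i => A.preActionMatrix a k i *
      (A.preActionMatrix a ^ n) i j) fun i hi => ?_
    rw [A.preActionMatrix_pow_eq_zero a n j.2 hi, mul_zero]

theorem b_eq_sum (A : FiniteBasedAlgebra K R ι) (a : ι → ℝ≥0) (n : ℕ) :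
    A.b a n = ∑ k, (A.actionMatrix a ^ n) k (A.unitVertex a) := by
  simp only [actionMatrix_pow_apply, b, powCoeff_eq]
  exact (A.sum_component_eq_sum a (f := fun k => (A.preActionMatrix a ^ n) k A.e) fun i hi =>
    A.preActionMatrix_pow_eq_zero a n (A.unitVertex a).2 hi).symm

/-- All entries of the powers of the action matrix are controlled by the numbers `b_n`. -/
theorem exists_sum_actionMatrix_pow_le (A : FiniteBasedAlgebra K R ι) (a : ι → ℝ≥0) :
    ∃ C : ℝ, 0 < C ∧ ∀ n : ℕ, ∑ k, ∑ j, (A.actionMatrix a ^ n) k j ≤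
      C * ∑ k, (A.actionMatrix a ^ n) k (A.unitVertex a) := by
  have hnn := fun n => Matrix.pow_apply_nonneg (A.preActionMatrix_nonneg a) n
  have hm : ∀ i, 0 ≤ ∑ k, ∑ j, A.structConst i j k := fun i =>
    Finset.sum_nonneg fun k _ => Finset.sum_nonneg fun j _ => A.structConst_nonneg i j k
  -- Expanding each column through the unit column weights the `i`-th entry of the latter by `∑ k, ∑
  -- j, m_{i,j}^k`. The total of all structure constants bounds every such weight, and the `1` makes
  -- the constant visibly positive.
  refine ⟨1 + ∑ i, ∑ k, ∑ j, A.structConst i j k,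
    add_pos_of_pos_of_nonneg one_pos (Finset.sum_nonneg fun i _ => hm i), fun n => ?_⟩
  rw [← b_eq_sum, b, Finset.mul_sum]
  simp only [actionMatrix_pow_apply, powCoeff_eq]
  calc ∑ k : A.component a, ∑ j : A.component a, (A.preActionMatrix a ^ n) k j
      ≤ ∑ k : A.component a, ∑ j, (A.preActionMatrix a ^ n) k j :=
        Finset.sum_le_sum fun k _ => A.sum_component_le_sum a fun j => hnn n k j
    _ ≤ ∑ k, ∑ j, (A.preActionMatrix a ^ n) k j :=
        A.sum_component_le_sum a (f := fun k => ∑ j, (A.preActionMatrix a ^ n) k j) fun k =>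
          Finset.sum_nonneg fun j _ => hnn n k j
    _ = ∑ i, (∑ k, ∑ j, A.structConst i j k) * (A.preActionMatrix a ^ n) i A.e := by
        rw [Finset.sum_congr rfl fun k _ => Finset.sum_congr rfl fun j _ =>
          A.preActionMatrix_pow_apply a n k j]
        simp only [Finset.sum_mul]
        rw [Finset.sum_congr rfl fun k _ => Finset.sum_comm, Finset.sum_comm]
        simp only [mul_comm]
    _ ≤ ∑ i, (1 + ∑ i, ∑ k, ∑ j, A.structConst i j k) * (A.preActionMatrix a ^ n) i A.e := by
        refine Finset.sum_le_sum fun i _ => mul_le_mul_of_nonneg_right ?_ (hnn n i A.e)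
        have := Finset.single_le_sum (f := fun i => ∑ k, ∑ j, A.structConst i j k)
          (fun i _ => hm i) (Finset.mem_univ i)
        linarith

end FiniteBasedAlgebra

theorem mainTheorem6 {K : Subring ℂ} {R ι : Type*} [Ring R] [Algebra K R]
    [Fintype ι] [DecidableEq ι] (A : FiniteBasedAlgebra K R ι) (a : ι → NNReal) :
    ∃ (lam : ℝ) (hs : Multiset ℕ),
      IsPFEigenvalue (A.actionMatrix a) lam ∧
      IsPeriods (A.actionMatrix a) lam hs ∧
      Filter.Tendsto (fun n : ℕ => (A.b a n) ^ (1 / (n : ℝ))) Filter.atTop (nhds lam) ∧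
      (lam = 0 → ∀ᶠ n in Filter.atTop, A.b a n = 0) ∧
      (0 < lam →
        ∃ S : Fin hs.lcm → Matrix (A.component a) (A.component a) (Polynomial ℝ),
          IsRothblumExpansion (A.actionMatrix a) lam hs.lcm S ∧
          (∀ S', IsRothblumExpansion (A.actionMatrix a) lam hs.lcm S' → S' = S) ∧
          Asymptotics.IsEquivalent Filter.atTop (fun n : ℕ => (A.b a n : ℂ))
            (asymptoticFormula lam hs.lcm S (A.unitVertex a)) ∧
          ConvergesGeometrically
            (fun n : ℕ => (A.b a n : ℂ) /
              asymptoticFormula lam hs.lcm S (A.unitVertex a) n)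
            1 (secModulus (A.actionMatrix a) lam / lam)) := by
  have : Nonempty (A.component a) := ⟨A.unitVertex a⟩
  have hM := A.actionMatrix_nonneg a
  obtain ⟨lam, hs, hPF, hper⟩ := exists_isPFEigenvalue_isPeriods hM
  obtain ⟨C, hC, hCb⟩ := A.exists_sum_actionMatrix_pow_le a
  simp only [A.b_eq_sum a]
  refine ⟨lam, hs, hPF, hper, tendsto_columnSum_rpow hM hPF _ hC hCb, fun h0 => ?_, fun hlam => ?_⟩
  · have hzero := pow_card_eq_zero_of_eigs fun μ hμ =>
      norm_le_zero_iff.1 ((hPF.2.2 μ hμ).trans_eq h0)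
    filter_upwards [eventually_ge_atTop (Fintype.card (A.component a))] with n hn
    rw [pow_eq_zero_of_le hn hzero]
    simp
  · obtain ⟨S, hS, h1, h2⟩ := exists_columnSum_asymptotics hM hPF hper hlam _ hC hCb
    exact ⟨S, hS, fun S' hS' => hS.unique hS', h1, h2⟩
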